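/- Let $\mathbb F$ be $\mathbb R$ or $\mathbb C$. For 2-dimensional $\mathbb F$-vector spaces $V_1,\dots,V_m$, $m\ge 1$, write $V^*=V_1^*\otimes\cdots\otimes V_m^*$, and for a point $\ell\in\mathbb P(V_j)$ (a line in $V_j$) with annihilator $\ell^0\subset V_j^*$ let $\Sigma^0_{j,\ell}=V_1^*\otimes\cdots\otimes \ell^0\otimes\cdots\otimes V_m^*$ ($\ell^0$ in the $j$th slot), i.e. the annihilator in $V^*$ of $V_1\otimes\cdots\otimes\ell\otimes\cdots\otimes V_m$. "Generic" means: on a non-empty Zariski open set. A *factorization structure* of dimension $m$ is an injective linear map $\varphi:\mathfrak h\to V^*$ with $\dim\mathfrak h=m+1$ such that $\dim(\varphi(\mathfrak h)\cap\Sigma^0_{j,\ell})=1$ for every $j$ and generic $\ell\in\mathbb P(V_j)$. Its *factorization curves* $\psi_j:\mathbb P(V_j)\to\mathbb P(\mathfrak h)$, $j=1,\dots,m$, are the unique regular maps with $\psi_j(\ell)=\varphi^{-1}(\varphi(\mathfrak h)\cap\Sigma^0_{j,\ell})$ for generic $\ell$. The degree $\deg\psi_j$ is the common degree of the homogeneous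 polynomials without common factor that define $\psi_j$. The curve $\psi_j$ is *decomposable* if the number of indices $i\in\{1,\dots,m\}$ with $\operatorname{Im}\psi_i=\operatorname{Im}\psi_j$ equals $\deg\psi_j$. An isomorphism from $\varphi_1:\mathfrak h_1\to V_1^*\otimes\cdots\otimes V_m^*$ to $\varphi_2:\mathfrak h_2\to W_1^*\otimes\cdots\otimes W_m^*$ consists of a linear isomorphism $\Phi:\mathfrak h_1\to\mathfrak h_2$, a permutation $\sigma$ of the slots and linear isomorphisms $\phi_j:V_{\sigma(j)}^*\to W_j^*$ with $\varphi_2\circ\Phi=(\phi_1\otimes\cdots\otimes\phi_m)\circ\sigma\circ\varphi_1$. A factorization structure is of *Segre-Veronese type* if it is isomorphic to an inclusion $$\sum_{j=1}^k ins_j\bigl(S^{d_j}W_j^*\otimes\Gamma_j\bigr)\hookrightarrow\bigotimes_{i=1}^k (W_i^*)^{\otimes d_i},$$ where $m=d_1+\cdots+d_k$ with $d_j\ge 1$, the $W_j$ are 2-dimensional vector spaces, $S^{d_j}W_j^*\subset (W_j^*)^{\otimes d_j}$ is the space of symmetric tensors, $\Gamma_j\subset\bigotimes_{i\ne j}(W_i^*)^{\otimes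 d_i}$ are 1-dimensional subspaces, $ins_j$ puts the factors $(W_j^*)^{\otimes d_j}$ back in their place, and the sum on the left has dimension $m+1$. **Theorem.** (i) Let $m\ge 2$, and suppose that every factorization structure over $\mathbb F$ of dimension $m-1$ all of whose factorization curves are decomposable is of Segre-Veronese type. Then every factorization structure over $\mathbb F$ of dimension $m$ all of whose factorization curves are decomposable is of Segre-Veronese type. (ii) For every $m\ge 1$, every factorization structure of dimension $m$ over $\mathbb F$ all of whose factorization curves are decomposable is of Segre-Veronese type. In particular, $\mathfrak h$ is the sum of the linear spans of the curves $\psi_1,\dots,\psi_m$. -/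

import Mathlib

open Module
open scoped TensorProduct LinearAlgebra.Projectivization

universe u v w

noncomputable section

namespace FactStr

/-! ### Projective spaces: Zariski topology, genericity, regular maps on projective lines -/

section Projective

variable {K : Type w} [Field K]

/-- A subset of `ℙ(V)` is Zariski closed if it is the common zero locus of a set of homogeneous
polynomial functions on `V`. Polynomial functions are written as polynomials in linear forms on
`V`, which avoids choosing coordinates. -/
def IsZariskiClosed {V : Type u} [AddCommGroup V] [Module K V] (Z : Set (ℙ K V)) : Prop :=
  ∃ S : Set (MvPolynomial (Dual K V) K),
    (∀ G ∈ S, ∃ n : ℕ, G.IsHomogeneous n) ∧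
    Z = {p | ∀ G ∈ S, MvPolynomial.eval (fun f : Dual K V => f p.rep) G = 0}

/-- Zariski open subsets of `ℙ(V)`. -/
def IsZariskiOpen {V : Type u} [AddCommGroup V] [Module K V] (U : Set (ℙ K V)) : Prop :=
  IsZariskiClosed Uᶜ

/-- A condition holds for generic `ℓ ∈ ℙ(V)` if it holds on a non-empty Zariski open subset. -/
def Generic {V : Type u} [AddCommGroup V] [Module K V] (P : ℙ K V → Prop) : Prop :=
  ∃ U : Set (ℙ K V), IsZariskiOpen U ∧ U.Nonempty ∧ ∀ ℓ ∈ U, P ℓ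

/-- `ψ : ℙ(V) → ℙ(H)`, with `V` two-dimensional, is a regular map of degree `e`: in homogeneous
coordinates it is given by homogeneous polynomials of degree `e` without a common factor.
Equivalently, the pull-back of the line bundle `𝒪(1)` on `ℙ(H)` is `𝒪(e)`. (Common factors, and not
only common zeros, have to be excluded, since over the reals a factor such as `x² + y²` has no
zeros.) -/
def IsRegularOfDegree {V : Type u} [AddCommGroup V] [Module K V]
    {H : Type v} [AddCommGroup H] [Module K H] [FiniteDimensional K H]
    (ψ : ℙ K V → ℙ K H) (e : ℕ) : Prop :=
  ∃ (b : Basis (Fin 2) K V) (F : Fin (finrank K H) → MvPolynomial (Fin 2) K),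
    (∀ k, (F k).IsHomogeneous e) ∧
    (∀ g : MvPolynomial (Fin 2) K, (∀ k, g ∣ F k) → IsUnit g) ∧
    ∀ (x : V) (hx : x ≠ 0),
      (ψ (Projectivization.mk K x hx)).submodule =
        K ∙ ∑ k, MvPolynomial.eval (b.repr x) (F k) • finBasis K H k

/-- `ψ` is a regular map on the projective line `ℙ(V)`. -/
def IsRegularMap {V : Type u} [AddCommGroup V] [Module K V]
    {H : Type v} [AddCommGroup H] [Module K H] [FiniteDimensional K H]
    (ψ : ℙ K V → ℙ K H) : Prop :=
  ∃ e : ℕ, IsRegularOfDegree ψ e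

/-- The degree of a regular map on a projective line. Two tuples of coprime homogeneous polynomials
that represent the same regular map over an infinite field have the same degree, so that the set
below has exactly one element for a regular map `ψ`. -/
def degree {V : Type u} [AddCommGroup V] [Module K V]
    {H : Type v} [AddCommGroup H] [Module K H] [FiniteDimensional K H]
    (ψ : ℙ K V → ℙ K H) : ℕ :=
  sInf {e | IsRegularOfDegree ψ e}

/-- The linear span in `H` of a curve in `ℙ(H)`. -/
def linearSpan {V : Type u} [AddCommGroup V] [Module K V]
    {H : Type v} [AddCommGroup H] [Module K H] (ψ : ℙ K V → ℙ K H) : Submodule K H :=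
  ⨆ ℓ : ℙ K V, (ψ ℓ).submodule

end Projective

/-! ### Existence of the regular extension of a generically one-dimensional kernel -/

section Existence

open MvPolynomial

variable {K : Type w} [Field K]

/-- If `g` divides a homogeneous polynomial, so does its top homogeneous component, with a
homogeneous quotient. -/
lemma exists_homogeneous_quotient {σ : Type*} {F g : MvPolynomial σ K} {e : ℕ}
    (hF : F.IsHomogeneous e) (hg : g ∣ F) :
    ∃ h : MvPolynomial σ K, h.IsHomogeneous (e - g.totalDegree) ∧
      F = homogeneousComponent g.totalDegree g * h := by
  obtain ⟨h, rfl⟩ := hg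
  by_cases h0 : g * h = 0
  · exact ⟨0, isHomogeneous_zero _ _ _, by rw [h0, mul_zero]⟩
  have hg0 : g ≠ 0 := left_ne_zero_of_mul h0
  have hh0 : h ≠ 0 := right_ne_zero_of_mul h0
  have hdeg : g.totalDegree + h.totalDegree = e := by
    rw [← totalDegree_mul_of_isDomain hg0 hh0, hF.totalDegree h0]
  refine ⟨homogeneousComponent h.totalDegree h, ?_, ?_⟩
  · rw [← hdeg, Nat.add_sub_cancel_left]
    exact homogeneousComponent_isHomogeneous _ _
  · have key : homogeneousComponent e (g * h) =
        homogeneousComponent g.totalDegree g * homogeneousComponent h.totalDegree h := by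
      conv_lhs => rw [← sum_homogeneousComponent g, ← sum_homogeneousComponent h,
        Finset.sum_mul_sum, map_sum]
      rw [Finset.sum_eq_single g.totalDegree]
      · rw [map_sum, Finset.sum_eq_single h.totalDegree]
        · rw [homogeneousComponent_of_mem
            ((homogeneousComponent_isHomogeneous _ g).mul
              (homogeneousComponent_isHomogeneous _ h)), if_pos hdeg.symm]
        · intro j hj hne
          rw [homogeneousComponent_of_mem
            ((homogeneousComponent_isHomogeneous _ g).mul
              (homogeneousComponent_isHomogeneous _ h)), if_neg]
          rw [Finset.mem_range] at hj; omega
        · intro hn; exact absurd (Finset.mem_range.2 (Nat.lt_succ_self _)) hn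
      · intro i hi hne
        rw [map_sum]
        refine Finset.sum_eq_zero fun j hj => ?_
        rw [homogeneousComponent_of_mem
            ((homogeneousComponent_isHomogeneous _ g).mul
              (homogeneousComponent_isHomogeneous _ h)), if_neg]
        rw [Finset.mem_range] at hi hj; omega
      · intro hn; exact absurd (Finset.mem_range.2 (Nat.lt_succ_self _)) hn
    rw [← key]
    exact (homogeneousComponent_eq_self hF).symm


/-- A homogeneous binary form vanishing at `a ≠ 0` vanishes in every algebra in which its two
arguments are proportional to `a`. -/
lemma algHom_eq_zero {F : MvPolynomial (Fin 2) K} {e : ℕ} (hF : F.IsHomogeneous e)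
    {a : Fin 2 → K} (ha : a ≠ 0) (h0 : eval a F = 0) {R : Type*} [CommRing R] [Algebra K R]
    (q : MvPolynomial (Fin 2) K →ₐ[K] R) (hrel : a 1 • q (X 0) = a 0 • q (X 1)) : q F = 0 := by
  have hs : ∃ s, ∀ i, q (X i) = a i • s := by
    have hc : a 0 ≠ 0 ∨ a 1 ≠ 0 := by
      by_contra hcon
      push Not at hcon
      exact ha (by ext i; fin_cases i <;> simp [hcon.1, hcon.2])
    rcases hc with h | h
    · refine ⟨(a 0)⁻¹ • q (X 0), fun i => ?_⟩
      fin_cases i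
      · exact (smul_inv_smul₀ h _).symm
      · change q (X 1) = a 1 • (a 0)⁻¹ • q (X 0)
        rw [smul_comm, hrel, inv_smul_smul₀ h]
    · refine ⟨(a 1)⁻¹ • q (X 1), fun i => ?_⟩
      fin_cases i
      · change q (X 0) = a 0 • (a 1)⁻¹ • q (X 1)
        rw [smul_comm, ← hrel, inv_smul_smul₀ h]
      · exact (smul_inv_smul₀ h _).symm
  obtain ⟨s, hs⟩ := hs
  have hq : q F = aeval (fun i => q (X i)) F := by
    conv_lhs => rw [← aeval_X_left_apply F]
    rw [← AlgHom.comp_apply, MvPolynomial.comp_aeval]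
  rw [hq, aeval_def, eval₂_eq']
  have : ∀ d ∈ F.support, algebraMap K R (coeff d F) * ∏ i, q (X i) ^ d i =
      s ^ e * algebraMap K R (coeff d F * ∏ i, a i ^ d i) := by
    intro d hd
    have hde : ∑ i, d i = e := by
      have := hF (mem_support_iff.1 hd)
      simpa [Finsupp.weight_apply, Finsupp.sum_fintype] using this
    simp only [hs, Algebra.smul_def, mul_pow, Finset.prod_mul_distrib,
      Finset.prod_pow_eq_pow_sum, hde, map_mul, map_prod, map_pow]
    ring
  rw [Finset.sum_congr rfl this, ← Finset.mul_sum, ← map_sum, ← eval_eq', h0, map_zero, mul_zero]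

/-- A homogeneous binary form vanishing at a non-zero point is divisible by the corresponding
linear form. -/
lemma linear_dvd {F : MvPolynomial (Fin 2) K} {e : ℕ} (hF : F.IsHomogeneous e)
    {a : Fin 2 → K} (ha : a ≠ 0) (h0 : eval a F = 0) :
    (a 1 • X 0 - a 0 • X 1 : MvPolynomial (Fin 2) K) ∣ F := by
  rw [← Ideal.mem_span_singleton, ← Ideal.Quotient.eq_zero_iff_mem]
  refine algHom_eq_zero hF ha h0 (Ideal.Quotient.mkₐ K (Ideal.span {_})) ?_
  rw [← sub_eq_zero, ← map_smul, ← map_smul, ← map_sub]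
  exact Ideal.Quotient.eq_zero_iff_mem.2 (Ideal.mem_span_singleton_self _)

lemma linear_not_isUnit {a : Fin 2 → K} :
    ¬ IsUnit (a 1 • X 0 - a 0 • X 1 : MvPolynomial (Fin 2) K) := by
  intro h
  have := h.map (eval (0 : Fin 2 → K))
  simp at this

/-- The signed maximal minors of an `n × (n + 1)` matrix. -/
def minors {R : Type*} [CommRing R] {n : ℕ} (A : Matrix (Fin n) (Fin (n + 1)) R)
    (k : Fin (n + 1)) : R := (-1) ^ (k : ℕ) * (A.submatrix id k.succAbove).det

/-- A matrix with a row added on top. -/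
def consRow {R : Type*} {n : ℕ} (r : Fin (n + 1) → R) (A : Matrix (Fin n) (Fin (n + 1)) R) :
    Matrix (Fin (n + 1)) (Fin (n + 1)) R :=
  Matrix.of (Fin.cons (α := fun _ => Fin (n + 1) → R) r (fun i => A i))

@[simp] lemma consRow_zero {R : Type*} {n : ℕ} (r : Fin (n + 1) → R)
    (A : Matrix (Fin n) (Fin (n + 1)) R) (k : Fin (n + 1)) : consRow r A 0 k = r k := rfl

@[simp] lemma consRow_succ {R : Type*} {n : ℕ} (r : Fin (n + 1) → R)
    (A : Matrix (Fin n) (Fin (n + 1)) R) (i : Fin n) (k : Fin (n + 1)) :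
    consRow r A i.succ k = A i k := rfl

lemma det_cons {R : Type*} [CommRing R] {n : ℕ} (A : Matrix (Fin n) (Fin (n + 1)) R)
    (r : Fin (n + 1) → R) :
    (consRow r A).det = ∑ k, r k * minors A k := by
  rw [Matrix.det_succ_row_zero]
  refine Finset.sum_congr rfl fun k _ => ?_
  have : (consRow r A).submatrix Fin.succ k.succAbove
      = A.submatrix id k.succAbove := by
    ext i j; simp [Matrix.submatrix]
  rw [this, minors, consRow_zero]
  ring

lemma sum_mul_minors {R : Type*} [CommRing R] {n : ℕ} (A : Matrix (Fin n) (Fin (n + 1)) R)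
    (i : Fin n) : ∑ k, A i k * minors A k = 0 := by
  rw [← det_cons]
  refine Matrix.det_zero_of_row_eq (i := 0) (j := i.succ) (Fin.succ_ne_zero i).symm ?_
  ext k; simp

lemma exists_minors_ne_zero {n : ℕ} (A : Matrix (Fin n) (Fin (n + 1)) K)
    (hA : LinearIndependent K (fun i => A i)) : ∃ k, minors A k ≠ 0 := by
  have : ∃ r : Fin (n + 1) → K, r ∉ Submodule.span K (Set.range fun i => A i) := by
    by_contra! hcon
    have htop : Submodule.span K (Set.range fun i => A i) = ⊤ :=
      Submodule.eq_top_iff'.2 hcon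
    have h1 := finrank_span_eq_card hA
    rw [htop, finrank_top] at h1
    simp at h1
  obtain ⟨r, hr⟩ := this
  have hli : LinearIndependent K (Fin.cons r (fun i => A i) : Fin (n + 1) → Fin (n + 1) → K) :=
    linearIndependent_finCons.2 ⟨hA, hr⟩
  have hu := (Matrix.linearIndependent_rows_iff_isUnit
    (A := consRow r A)).1 hli
  rw [Matrix.isUnit_iff_isUnit_det, det_cons, isUnit_iff_ne_zero] at hu
  by_contra! hcon
  exact hu (by simp [hcon])

lemma mem_span_minors {n : ℕ} (A : Matrix (Fin n) (Fin (n + 1)) K) {k₀ : Fin (n + 1)}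
    (h0 : minors A k₀ ≠ 0) (y : Fin (n + 1) → K) (hy : ∀ i, ∑ k, A i k * y k = 0) :
    minors A k₀ • y = y k₀ • minors A := by
  set B := consRow (Pi.single k₀ 1) A with hB
  have hdet : B.det ≠ 0 := by
    rw [hB, det_cons]; simpa [Pi.single_apply] using h0
  have hinj : Function.Injective B.mulVec := by
    rw [Matrix.mulVec_injective_iff_isUnit, Matrix.isUnit_iff_isUnit_det]
    exact isUnit_iff_ne_zero.2 hdet
  apply hinj
  have hz : ∀ z : Fin (n + 1) → K, (∀ i, ∑ k, A i k * z k = 0) →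
      B.mulVec z = Pi.single 0 (z k₀) := by
    intro z hz
    ext i
    refine Fin.cases ?_ (fun i => ?_) i
    · simp [hB, Matrix.mulVec, dotProduct, Pi.single_apply]
    · simpa [hB, Matrix.mulVec, dotProduct, Pi.single_apply] using hz i
  rw [Matrix.mulVec_smul, Matrix.mulVec_smul, hz y hy, hz _ (sum_mul_minors A)]
  ext i
  simp [Pi.single_apply, mul_comm]

lemma minors_isHomogeneous {σ : Type*} {n : ℕ}
    (A : Matrix (Fin n) (Fin (n + 1)) (MvPolynomial σ K)) (hA : ∀ i k, (A i k).IsHomogeneous 1)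
    (k : Fin (n + 1)) : (minors A k).IsHomogeneous n := by
  rw [minors]
  suffices h : ((-1) ^ (k : ℕ) * (A.submatrix id k.succAbove).det).IsHomogeneous (0 + n) by
    rwa [zero_add] at h
  refine IsHomogeneous.mul ?_ ?_
  · simpa using (((isHomogeneous_one σ K).neg).pow (k : ℕ))
  · rw [Matrix.det_apply]
    refine IsHomogeneous.sum _ _ _ fun τ _ => ?_
    have h1 : (∏ i, A.submatrix id k.succAbove (τ i) i).IsHomogeneous n := by
      simpa using IsHomogeneous.prod Finset.univ
        (fun i => A.submatrix id k.succAbove (τ i) i) (fun _ => 1) (fun i _ => hA _ _)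
    rcases Int.units_eq_one_or (Equiv.Perm.sign τ) with h | h
    · simpa [h] using h1
    · simpa [h] using h1.neg

lemma map_minors {R S : Type*} [CommRing R] [CommRing S] (f : R →+* S) {n : ℕ}
    (A : Matrix (Fin n) (Fin (n + 1)) R) (k : Fin (n + 1)) :
    f (minors A k) = minors (A.map f) k := by
  rw [minors, minors, map_mul, map_pow, map_neg, map_one, RingHom.map_det]
  rfl

lemma exists_forms {V : Type*} [AddCommGroup V] [Module K V]
    {H : Type*} [AddCommGroup H] [Module K H] [FiniteDimensional K H] {T : Type*}
    (b : Basis (Fin 2) K V) (M : V →ₗ[K] H →ₗ[K] (T → K)) (x₀ : V)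
    (h₀ : finrank K (LinearMap.ker (M x₀)) = 1) {n : ℕ} (c : Basis (Fin (n + 1)) K H) :
    ∃ F : Fin (n + 1) → MvPolynomial (Fin 2) K,
      (∀ k, (F k).IsHomogeneous n) ∧ (∃ k, eval (b.repr x₀) (F k) ≠ 0) ∧
      ∀ x : V, (∃ k, eval (b.repr x) (F k) ≠ 0) → finrank K (LinearMap.ker (M x)) = 1 →
        LinearMap.ker (M x) = K ∙ ∑ k, eval (b.repr x) (F k) • c k := by
  set L : V → T → Dual K H := fun x t => LinearMap.proj t ∘ₗ M x with hL
  set W := Submodule.span K (Set.range (L x₀)) with hW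
  have hker : W.dualCoannihilator = LinearMap.ker (M x₀) := by
    ext y
    rw [Submodule.mem_dualCoannihilator, LinearMap.mem_ker]
    constructor
    · intro h
      ext t
      exact h _ (Submodule.subset_span ⟨t, rfl⟩)
    · intro h f hf
      induction hf using Submodule.span_induction with
      | mem f hf => obtain ⟨t, rfl⟩ := hf; simp [hL, h]
      | zero => rfl
      | add f g _ _ hf hg => simp [hf, hg]
      | smul a f _ hf => simp [hf]
  have hn : finrank K H = n + 1 := by simpa using finrank_eq_card_basis c
  have hWn : finrank K W = n := by
    have := Subspace.finrank_add_finrank_dualCoannihilator_eq W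
    rw [hker, h₀, hn] at this; omega
  obtain ⟨f, hf, hli⟩ : ∃ f : Fin n → Dual K H, (∀ i, f i ∈ Set.range (L x₀)) ∧
      LinearIndependent K f := by
    obtain ⟨f, hf, -, hli⟩ := Submodule.exists_fun_fin_finrank_span_eq K (Set.range (L x₀))
    refine ⟨f ∘ Fin.cast hWn.symm, fun i => hf _, hli.comp _ (Fin.cast_injective _)⟩
  choose t ht using hf
  set A : Matrix (Fin n) (Fin (n + 1)) (MvPolynomial (Fin 2) K) :=
    fun i k => ∑ a, C (M (b a) (c k) (t i)) * X a with hA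
  have hev : ∀ x i k, (A.map (eval (b.repr x))) i k = M x (c k) (t i) := by
    intro x i k
    conv_rhs => rw [← b.sum_repr x]
    rw [Matrix.map_apply, map_sum, map_sum, LinearMap.sum_apply, Finset.sum_apply]
    refine Finset.sum_congr rfl fun a _ => ?_
    simp [mul_comm]
  have hevF : ∀ x k, eval (b.repr x) (minors A k) = minors (A.map (eval (b.repr x))) k :=
    fun x k => map_minors _ A k
  refine ⟨minors A, minors_isHomogeneous A (fun i k => ?_), ?_, ?_⟩
  · exact IsHomogeneous.sum _ _ _ fun a _ => isHomogeneous_C_mul_X _ _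
  · simp only [hevF]
    apply exists_minors_ne_zero
    have h2 := hli.map' (c.constr K).symm.toLinearMap (LinearEquiv.ker _)
    convert! h2 using 1
    ext i k
    rw [hev]
    have := congrArg (fun g : Dual K H => g (c k)) (ht i)
    simpa [hL, Basis.constr] using this
  · rintro x ⟨k₀, hk₀⟩ hx
    refine Submodule.eq_of_le_of_finrank_le ?_ ?_
    · intro y hy
      rw [LinearMap.mem_ker] at hy
      rw [hevF] at hk₀
      have h3 := mem_span_minors _ hk₀ (c.repr y) (fun i => by
        have h4 : M x y (t i) = 0 := by rw [hy]; rfl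
        rw [← c.sum_repr y, map_sum, Finset.sum_apply] at h4
        rw [← h4]
        refine Finset.sum_congr rfl fun k _ => ?_
        rw [hev, map_smul, Pi.smul_apply, smul_eq_mul, mul_comm])
      rw [Submodule.mem_span_singleton]
      refine ⟨(minors (A.map (eval (b.repr x))) k₀)⁻¹ * c.repr y k₀, ?_⟩
      simp only [hevF]
      rw [mul_smul, inv_smul_eq_iff₀ hk₀, Finset.smul_sum]
      conv_rhs => rw [← c.sum_repr y, Finset.smul_sum]
      refine Finset.sum_congr rfl fun k _ => ?_
      have := congrFun h3 k
      simp only [Pi.smul_apply, smul_eq_mul] at this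
      rw [smul_smul, smul_smul, this]
    · rw [hx]
      exact (finrank_span_le_card _).trans (by simp)

/-- A family of linear maps `M x : H → (T → K)`, depending linearly on a vector `x` of a plane `V`,
with one-dimensional kernel for one `x₀`, has kernels given generically by coprime forms. -/
lemma exists_coprime_forms {V : Type*} [AddCommGroup V] [Module K V]
    {H : Type*} [AddCommGroup H] [Module K H] [FiniteDimensional K H] {T : Type*}
    (b : Basis (Fin 2) K V) (M : V →ₗ[K] H →ₗ[K] (T → K)) (x₀ : V)
    (h₀ : finrank K (LinearMap.ker (M x₀)) = 1) :
    ∃ (e : ℕ) (F : Fin (finrank K H) → MvPolynomial (Fin 2) K)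
      (D : MvPolynomial (Fin 2) K) (n : ℕ),
      (∀ k, (F k).IsHomogeneous e) ∧
      (∀ g : MvPolynomial (Fin 2) K, (∀ k, g ∣ F k) → IsUnit g) ∧
      D.IsHomogeneous n ∧ eval (b.repr x₀) D ≠ 0 ∧
      ∀ x : V, eval (b.repr x) D ≠ 0 → finrank K (LinearMap.ker (M x)) = 1 →
        LinearMap.ker (M x) = K ∙ ∑ k, eval (b.repr x) (F k) • finBasis K H k := by
  have hpos : 0 < finrank K H := by
    have := (LinearMap.ker (M x₀)).finrank_le; omega
  have hex : ∃ (e : ℕ) (F : Fin (finrank K H) → MvPolynomial (Fin 2) K)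
      (D : MvPolynomial (Fin 2) K) (n : ℕ),
      (∀ k, (F k).IsHomogeneous e) ∧ D.IsHomogeneous n ∧ eval (b.repr x₀) D ≠ 0 ∧
      ∀ x : V, eval (b.repr x) D ≠ 0 → finrank K (LinearMap.ker (M x)) = 1 →
        LinearMap.ker (M x) = K ∙ ∑ k, eval (b.repr x) (F k) • finBasis K H k := by
    generalize finBasis K H = c
    revert c
    generalize finrank K H = N at hpos
    intro c
    obtain ⟨n, rfl⟩ : ∃ n, N = n + 1 := ⟨N - 1, by omega⟩
    obtain ⟨F, hF, ⟨k, hk⟩, hM⟩ := exists_forms b M x₀ h₀ c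
    exact ⟨n, F, F k, n, hF, hF k, hk, fun x hx => hM x ⟨k, hx⟩⟩
  classical
  obtain ⟨F, D, n, hF, hD, hD0, hM⟩ := Nat.find_spec hex
  set e := Nat.find hex with he
  refine ⟨e, F, D, n, hF, fun g hg => ?_, hD, hD0, hM⟩
  have hspan : ∀ x : V, finrank K (LinearMap.ker (M x)) = 1 → ∀ y : H,
      LinearMap.ker (M x) = K ∙ y → y ≠ 0 := by
    rintro x hx y hy rfl
    rw [hy, Submodule.span_zero_singleton, finrank_bot] at hx
    exact zero_ne_one hx
  obtain ⟨k₁, hk₁⟩ : ∃ k, F k ≠ 0 := by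
    by_contra! hcon
    exact hspan x₀ h₀ _ (hM x₀ hD0 h₀) (by simp [hcon])
  have hg0 : g ≠ 0 := fun h => hk₁ (by simpa [h] using hg k₁)
  have hgle : g.totalDegree ≤ e := by
    obtain ⟨h, hh⟩ := hg k₁
    rw [← (hF k₁).totalDegree hk₁, hh,
      totalDegree_mul_of_isDomain hg0 (by rintro rfl; simp [hh] at hk₁)]
    omega
  by_contra hunit
  have hgpos : 0 < g.totalDegree := by
    rw [Nat.pos_iff_ne_zero]
    intro h
    rw [totalDegree_eq_zero_iff_eq_C] at h
    apply hunit
    rw [h]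
    refine (IsUnit.mk0 _ fun h' => hg0 ?_).map C
    rw [h, h', map_zero]
  choose F' hF' hFF' using fun k => exists_homogeneous_quotient (hF k) (hg k)
  refine Nat.find_min hex (m := e - g.totalDegree) (by omega) ⟨F', D, n, hF', hD, hD0, ?_⟩
  intro x hx hx1
  have h1 := hM x hx hx1
  have h2 : ∑ k, eval (b.repr x) (F k) • finBasis K H k =
      eval (b.repr x) (homogeneousComponent g.totalDegree g) •
        ∑ k, eval (b.repr x) (F' k) • finBasis K H k := by
    rw [Finset.smul_sum]
    refine Finset.sum_congr rfl fun k _ => ?_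
    conv_lhs => rw [hFF' k]
    rw [map_mul, mul_smul]
  have h3 := hspan x hx1 _ h1
  rw [h2] at h1 h3
  rw [h1]
  exact Submodule.span_singleton_smul_eq (IsUnit.mk0 _ (left_ne_zero_of_smul h3)) _

/-- The intersection of two Zariski open sets is Zariski open. -/
lemma isZariskiOpen_inter {V : Type*} [AddCommGroup V] [Module K V] {U₁ U₂ : Set (ℙ K V)}
    (h₁ : IsZariskiOpen U₁) (h₂ : IsZariskiOpen U₂) : IsZariskiOpen (U₁ ∩ U₂) := by
  obtain ⟨S₁, hS₁, e₁⟩ := h₁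
  obtain ⟨S₂, hS₂, e₂⟩ := h₂
  refine ⟨Set.image2 (· * ·) S₁ S₂, ?_, ?_⟩
  · rintro _ ⟨G₁, hG₁, G₂, hG₂, rfl⟩
    obtain ⟨n₁, h₁⟩ := hS₁ G₁ hG₁
    obtain ⟨n₂, h₂⟩ := hS₂ G₂ hG₂
    exact ⟨n₁ + n₂, h₁.mul h₂⟩
  · rw [Set.compl_inter, e₁, e₂]
    ext p
    simp only [Set.mem_union, Set.mem_ofPred_eq, Set.forall_mem_image2, map_mul, mul_eq_zero]
    constructor
    · rintro (h | h) G₁ hG₁ G₂ hG₂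
      · exact Or.inl (h G₁ hG₁)
      · exact Or.inr (h G₂ hG₂)
    · intro h
      by_contra! hcon
      obtain ⟨⟨G₁, hG₁, h1⟩, G₂, hG₂, h2⟩ := hcon
      rcases h G₁ hG₁ G₂ hG₂ with h | h
      · exact h1 h
      · exact h2 h

/-- If the kernels of a family of linear maps `M x : H → (T → K)`, depending linearly on a vector
`x` of a plane `V`, are generically one-dimensional, then they are generically given by a regular
map `ℙ(V) → ℙ(H)`. -/
lemma exists_regular_extension {V : Type*} [AddCommGroup V] [Module K V]
    {H : Type*} [AddCommGroup H] [Module K H] [FiniteDimensional K H] {T : Type*}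
    (hV : finrank K V = 2) (M : V →ₗ[K] H →ₗ[K] (T → K))
    (hM : Generic (fun ℓ : ℙ K V => finrank K (LinearMap.ker (M ℓ.rep)) = 1)) :
    ∃ ψ : ℙ K V → ℙ K H, IsRegularMap ψ ∧
      Generic (fun ℓ : ℙ K V => (ψ ℓ).submodule = LinearMap.ker (M ℓ.rep)) := by
  have : FiniteDimensional K V := Module.finite_of_finrank_pos (by omega)
  obtain ⟨U, hU, ⟨ℓ₀, hℓ₀⟩, hUM⟩ := hM
  let b : Basis (Fin 2) K V := finBasisOfFinrankEq K V hV
  obtain ⟨e, F, D, n, hF, hcop, hD, hD0, hker⟩ :=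
    exists_coprime_forms b M ℓ₀.rep (hUM ℓ₀ hℓ₀)
  let f : V → H := fun x => ∑ k, eval (b.repr x) (F k) • finBasis K H k
  have hne : ∀ x : V, x ≠ 0 → f x ≠ 0 := by
    intro x hx hfx
    have hz : ∀ k, eval (b.repr x) (F k) = 0 :=
      Fintype.linearIndependent_iff.1 (finBasis K H).linearIndependent _ hfx
    have ha : (b.repr x : Fin 2 → K) ≠ 0 := by
      intro h
      exact hx (b.repr.map_eq_zero_iff.1 (DFunLike.coe_injective h))
    exact linear_not_isUnit (hcop _ fun k => linear_dvd (hF k) ha (hz k))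
  have hscale : ∀ (a : K) (x : V), f (a • x) = a ^ e • f x := by
    intro a x
    simp only [f, Finset.smul_sum, smul_smul]
    refine Finset.sum_congr rfl fun k _ => ?_
    congr 1
    rw [eval_eq', eval_eq', Finset.mul_sum]
    refine Finset.sum_congr rfl fun d hd => ?_
    have hde : ∑ i, d i = e := by
      have := hF k (mem_support_iff.1 hd)
      simpa [Finsupp.weight_apply, Finsupp.sum_fintype] using this
    simp only [map_smul, Finsupp.smul_apply, smul_eq_mul, mul_pow, Finset.prod_mul_distrib,
      Finset.prod_pow_eq_pow_sum, hde]
    ring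
  let ψ : ℙ K V → ℙ K H := fun ℓ => Projectivization.mk K (f ℓ.rep) (hne _ ℓ.rep_nonzero)
  have hψ : ∀ (x : V) (hx : x ≠ 0), (ψ (Projectivization.mk K x hx)).submodule = K ∙ f x := by
    intro x hx
    obtain ⟨a, ha⟩ := Projectivization.exists_smul_eq_mk_rep K x hx
    rw [Projectivization.submodule_mk, ← ha, Units.smul_def, hscale]
    exact Submodule.span_singleton_smul_eq ((a.isUnit).pow e) _
  refine ⟨ψ, ⟨e, b, F, hF, hcop, hψ⟩, ?_⟩
  have hopen : IsZariskiOpen {ℓ : ℙ K V | eval (b.repr ℓ.rep) D ≠ 0} := by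
    refine ⟨{rename b.coord D}, ?_, ?_⟩
    · rintro _ rfl
      exact ⟨n, hD.rename_isHomogeneous⟩
    · ext p
      simp only [Set.mem_compl_iff, Set.mem_ofPred_eq, not_not, Set.mem_singleton_iff,
        forall_eq, eval_rename]
      rfl
  refine ⟨_, isZariskiOpen_inter hU hopen, ⟨ℓ₀, hℓ₀, hD0⟩, ?_⟩
  rintro ℓ ⟨h1, h2⟩
  rw [hker _ h2 (hUM ℓ h1)]
  exact Projectivization.submodule_mk _ _

end Existence

/-! ### Factorization structures -/

section Slots

variable {K : Type w} [Field K] {ι : Type*} [Fintype ι]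

/-- `Σ_{j,ℓ} = V₁ ⊗ ⋯ ⊗ ℓ ⊗ ⋯ ⊗ Vₘ`, with `ℓ` in the slot `j`. -/
def slotSubspace (V : ι → Type u) [∀ i, AddCommGroup (V i)] [∀ i, Module K (V i)]
    (j : ι) (ℓ : ℙ K (V j)) : Submodule K (⨂[K] i, V i) :=
  Submodule.span K {t | ∃ x : ∀ i, V i, x j ∈ ℓ.submodule ∧ t = PiTensorProduct.tprod K x}

/-- The annihilator `Σ⁰_{j,ℓ}` of `Σ_{j,ℓ}` in `V* = V₁* ⊗ ⋯ ⊗ Vₘ*`, where a tensor of linear forms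
acts on `V₁ ⊗ ⋯ ⊗ Vₘ` slot by slot. -/
def slotAnnihilator (V : ι → Type u) [∀ i, AddCommGroup (V i)] [∀ i, Module K (V i)]
    (j : ι) (ℓ : ℙ K (V j)) : Submodule K (⨂[K] i, Dual K (V i)) :=
  (slotSubspace V j ℓ).dualAnnihilator.comap PiTensorProduct.dualDistrib

end Slots

/-- A factorization structure of dimension `m` over `𝕜`: an injective linear map
`φ : 𝔥 → V₁* ⊗ ⋯ ⊗ Vₘ*` with `dim 𝔥 = m + 1` and `dim Vⱼ = 2`, such that
`dim (φ(𝔥) ∩ Σ⁰_{j,ℓ}) = 1` for every `j` and generic `ℓ ∈ ℙ(Vⱼ)`. -/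
structure FactorizationStructure (𝕜 : Type w) [Field 𝕜] (m : ℕ) where
  V : Fin m → Type u
  [instAddCommGroupV : ∀ i, AddCommGroup (V i)]
  [instModuleV : ∀ i, Module 𝕜 (V i)]
  finrank_V : ∀ i, finrank 𝕜 (V i) = 2
  𝔥 : Type v
  [instAddCommGroupH : AddCommGroup 𝔥]
  [instModuleH : Module 𝕜 𝔥]
  finrank_𝔥 : finrank 𝕜 𝔥 = m + 1
  φ : 𝔥 →ₗ[𝕜] ⨂[𝕜] i, Dual 𝕜 (V i)
  injective : Function.Injective φ
  generic_finrank : ∀ j : Fin m, Generic (fun ℓ : ℙ 𝕜 (V j) =>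
    finrank 𝕜 (LinearMap.range φ ⊓ slotAnnihilator V j ℓ : Submodule 𝕜 _) = 1)

attribute [instance] FactorizationStructure.instAddCommGroupV FactorizationStructure.instModuleV
  FactorizationStructure.instAddCommGroupH FactorizationStructure.instModuleH

/-! ### Isomorphisms and structures of Segre-Veronese type -/

section Iso

variable {K : Type w} [Field K]

/-- Isomorphism of linear maps `φ₁ : H₁ → ⨂ᵢ Vᵢ*` and `φ₂ : H₂ → ⨂ⱼ Wⱼ*`: a linear isomorphism
`Φ : H₁ → H₂`, a bijection `σ` of the slots, regarded as the braiding
`⨂ᵢ Vᵢ* → ⨂ⱼ V_{σ(j)}*`, and linear isomorphisms `fⱼ : V_{σ(j)}* → Wⱼ*` such that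
`φ₂ ∘ Φ = (⨂ⱼ fⱼ) ∘ σ ∘ φ₁`. -/
def AreIsomorphic {ι κ : Type*}
    {V : ι → Type*} [∀ i, AddCommGroup (V i)] [∀ i, Module K (V i)]
    {W : κ → Type*} [∀ j, AddCommGroup (W j)] [∀ j, Module K (W j)]
    {H₁ H₂ : Type*} [AddCommMonoid H₁] [Module K H₁] [AddCommMonoid H₂] [Module K H₂]
    (φ₁ : H₁ →ₗ[K] ⨂[K] i, Dual K (V i)) (φ₂ : H₂ →ₗ[K] ⨂[K] j, Dual K (W j)) : Prop :=
  ∃ (Φ : H₁ ≃ₗ[K] H₂) (σ : κ ≃ ι) (f : ∀ j, Dual K (V (σ j)) ≃ₗ[K] Dual K (W j)),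
    ∀ h : H₁, φ₂ (Φ h) =
      PiTensorProduct.map (fun j => (f j).toLinearMap)
        (PiTensorProduct.reindex K (fun i => Dual K (V i)) σ.symm (φ₁ h))

/-- The subspace `S^d U ⊆ U^{⊗ d}` of symmetric tensors. -/
def symmetricTensors (K : Type w) [Field K] (d : ℕ) (U : Type u) [AddCommGroup U] [Module K U] :
    Submodule K (⨂[K] _ : Fin d, U) where
  carrier := {t | ∀ σ : Equiv.Perm (Fin d), PiTensorProduct.reindex K (fun _ => U) σ t = t}
  add_mem' ha hb σ := by rw [map_add, ha σ, hb σ]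
  zero_mem' σ := map_zero _
  smul_mem' c t ht σ := by rw [map_smul, ht σ]

/-- For a partition `m = d₁ + ⋯ + d_k`, slots are labelled by pairs `(j, r)` with `1 ≤ r ≤ d_j`. -/
abbrev Slot {k : ℕ} (d : Fin k → ℕ) : Type := Σ j : Fin k, Fin (d j)

/-- The slots outside of the `j`th group. -/
abbrev OtherSlot {k : ℕ} (d : Fin k → ℕ) (j : Fin k) : Type := {s : Slot d // s.1 ≠ j}

/-- The slots are those of the `j`th group together with the others. -/
def slotEquiv {k : ℕ} (d : Fin k → ℕ) (j : Fin k) : Fin (d j) ⊕ OtherSlot d j ≃ Slot d where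
  toFun := Sum.elim (fun r => ⟨j, r⟩) Subtype.val
  invFun s := if h : s.1 = j then Sum.inl (Fin.cast (by rw [h]) s.2) else Sum.inr ⟨s, h⟩
  left_inv := by
    rintro (r | ⟨s, hs⟩)
    · simp
    · simp [hs]
  right_inv := by
    rintro ⟨i, r⟩
    by_cases h : i = j
    · subst h; simp
    · simp [h]

/-- The operator
`ins_j : (W_j*)^{⊗ d_j} ⊗ ⨂_{i ≠ j} (W_i*)^{⊗ d_i} → ⨂_i (W_i*)^{⊗ d_i}`,
which puts the factors back into their slots. -/
def ins {k : ℕ} (d : Fin k → ℕ) (W : Fin k → Type u) [∀ j, AddCommGroup (W j)]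
    [∀ j, Module K (W j)] (j : Fin k) :
    ((⨂[K] _ : Fin (d j), Dual K (W j)) ⊗[K] (⨂[K] s : OtherSlot d j, Dual K (W s.1.1))) ≃ₗ[K]
      ⨂[K] s : Slot d, Dual K (W s.1) :=
  (PiTensorProduct.tmulEquivDep K
      (fun s : Fin (d j) ⊕ OtherSlot d j => Dual K (W (slotEquiv d j s).1))).trans
    (PiTensorProduct.reindex K (fun s : Slot d => Dual K (W s.1)) (slotEquiv d j).symm).symm

/-- The operator `ins_j` on decomposable tensors. -/
theorem ins_tmul {k : ℕ} (d : Fin k → ℕ) (W : Fin k → Type u) [∀ j, AddCommGroup (W j)]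
    [∀ j, Module K (W j)] (j : Fin k) (f : ∀ s : Slot d, Dual K (W s.1)) :
    ins (K := K) d W j ((PiTensorProduct.tprod K fun r : Fin (d j) => f ⟨j, r⟩) ⊗ₜ
      (PiTensorProduct.tprod K fun s : OtherSlot d j => f s.1)) = PiTensorProduct.tprod K f := by
  change (PiTensorProduct.reindex K (fun s : Slot d => Dual K (W s.1)) (slotEquiv d j).symm).symm
    (PiTensorProduct.tmulEquivDep K
      (fun s : Fin (d j) ⊕ OtherSlot d j => Dual K (W (slotEquiv d j s).1))
      ((PiTensorProduct.tprod K fun r => f (slotEquiv d j (Sum.inl r))) ⊗ₜ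
        (PiTensorProduct.tprod K fun s => f (slotEquiv d j (Sum.inr s))))) = _
  rw [PiTensorProduct.tmulEquivDep_apply, LinearEquiv.symm_apply_eq,
    PiTensorProduct.reindex_tprod]
  congr 1
  ext (r | s) <;> rfl

/-- The space `∑_j ins_j (S^{d_j} W_j* ⊗ Γ_j)`. -/
def segreVeroneseSpace {k : ℕ} (d : Fin k → ℕ) (W : Fin k → Type u) [∀ j, AddCommGroup (W j)]
    [∀ j, Module K (W j)]
    (Γ : ∀ j : Fin k, Submodule K (⨂[K] s : OtherSlot d j, Dual K (W s.1.1))) :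
    Submodule K (⨂[K] s : Slot d, Dual K (W s.1)) :=
  ⨆ j : Fin k, (Submodule.map₂ (TensorProduct.mk K _ _)
    (symmetricTensors K (d j) (Dual K (W j))) (Γ j)).map (ins (K := K) d W j).toLinearMap

end Iso

/-- The data of a standard Segre-Veronese factorization structure of dimension `m`: a partition
`m = d₁ + ⋯ + d_k` into positive integers, two-dimensional spaces `W_j`, and one-dimensional
spaces `Γ_j` such that `∑_j ins_j (S^{d_j} W_j* ⊗ Γ_j)` has dimension `m + 1`. -/
structure SegreVeroneseData (𝕜 : Type w) [Field 𝕜] (m : ℕ) where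
  k : ℕ
  d : Fin k → ℕ
  d_pos : ∀ j, 1 ≤ d j
  sum_d : ∑ j, d j = m
  W : Fin k → Type u
  [instAddCommGroupW : ∀ j, AddCommGroup (W j)]
  [instModuleW : ∀ j, Module 𝕜 (W j)]
  finrank_W : ∀ j, finrank 𝕜 (W j) = 2
  Γ : ∀ j : Fin k, Submodule 𝕜 (⨂[𝕜] s : OtherSlot d j, Dual 𝕜 (W s.1.1))
  finrank_Γ : ∀ j, finrank 𝕜 (Γ j) = 1
  finrank_space : finrank 𝕜 (segreVeroneseSpace d W Γ) = m + 1

attribute [instance] SegreVeroneseData.instAddCommGroupW SegreVeroneseData.instModuleW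

/-- The standard Segre-Veronese factorization structure: the inclusion
`∑_j ins_j (S^{d_j} W_j* ⊗ Γ_j) ↪ ⨂_j (W_j*)^{⊗ d_j}`. -/
def SegreVeroneseData.inclusion {𝕜 : Type w} [Field 𝕜] {m : ℕ}
    (D : SegreVeroneseData.{u} 𝕜 m) :
    segreVeroneseSpace D.d D.W D.Γ →ₗ[𝕜] ⨂[𝕜] s : Slot D.d, Dual 𝕜 (D.W s.1) :=
  (segreVeroneseSpace D.d D.W D.Γ).subtype

/-! ### Factorization curves and decomposability -/

namespace FactorizationStructure

variable {𝕜 : Type w} [Field 𝕜] {m : ℕ} (S : FactorizationStructure.{u, v} 𝕜 m)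

instance : FiniteDimensional 𝕜 S.𝔥 :=
  Module.finite_of_finrank_pos (by rw [S.finrank_𝔥]; exact Nat.succ_pos m)

/-- `ψ : ℙ(Vⱼ) → ℙ(𝔥)` is a regular map given generically by `ℓ ↦ φ⁻¹(φ(𝔥) ∩ Σ⁰_{j,ℓ})`. -/
def IsCurve (j : Fin m) (ψ : ℙ 𝕜 (S.V j) → ℙ 𝕜 S.𝔥) : Prop :=
  IsRegularMap ψ ∧ Generic (fun ℓ : ℙ 𝕜 (S.V j) =>
    (ψ ℓ).submodule = (LinearMap.range S.φ ⊓ slotAnnihilator S.V j ℓ).comap S.φ)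

/-- The pairing of `φ(h)` with `x₁ ⊗ ⋯ ⊗ y ⊗ ⋯ ⊗ xₘ`, with `y` in the slot `j`. -/
def pairing (j : Fin m) : S.V j →ₗ[𝕜] S.𝔥 →ₗ[𝕜] ((∀ i, S.V i) → 𝕜) :=
  LinearMap.mk₂ 𝕜
    (fun y h x => PiTensorProduct.dualDistrib (S.φ h)
      (PiTensorProduct.tprod 𝕜 (Function.update x j y)))
    (fun y₁ y₂ h => by ext x; simp [MultilinearMap.map_update_add])
    (fun c y h => by ext x; simp [MultilinearMap.map_update_smul])
    (fun y h₁ h₂ => by ext x; simp)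
    (fun c y h => by ext x; simp)

theorem ker_pairing (j : Fin m) (ℓ : ℙ 𝕜 (S.V j)) :
    LinearMap.ker (S.pairing j ℓ.rep) =
      (LinearMap.range S.φ ⊓ slotAnnihilator S.V j ℓ).comap S.φ := by
  ext h
  rw [LinearMap.mem_ker, Submodule.mem_comap, Submodule.mem_inf, slotAnnihilator,
    Submodule.mem_comap, Submodule.mem_dualAnnihilator]
  constructor
  · refine fun hh => ⟨⟨h, rfl⟩, fun t ht => ?_⟩
    induction ht using Submodule.span_induction with
    | mem t ht =>
      obtain ⟨x, hx, rfl⟩ := ht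
      rw [Projectivization.submodule_eq, Submodule.mem_span_singleton] at hx
      obtain ⟨a, ha⟩ := hx
      have h1 : PiTensorProduct.dualDistrib (S.φ h)
          (PiTensorProduct.tprod 𝕜 (Function.update x j ℓ.rep)) = 0 := congrFun hh x
      have h2 : x = Function.update x j (a • ℓ.rep) := by rw [ha, Function.update_eq_self]
      rw [h2, MultilinearMap.map_update_smul, map_smul, h1, smul_zero]
    | zero => exact map_zero _
    | add s t _ _ hs ht => rw [map_add, hs, ht, add_zero]
    | smul a t _ ht => rw [map_smul, ht, smul_zero]
  · rintro ⟨-, hh⟩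
    ext x
    refine hh _ (Submodule.subset_span ⟨Function.update x j ℓ.rep, ?_, rfl⟩)
    rw [Function.update_self, Projectivization.submodule_eq]
    exact Submodule.mem_span_singleton_self _

/-- The generically defined curve of a slot extends to a regular map. -/
theorem exists_isCurve (j : Fin m) : ∃ ψ : ℙ 𝕜 (S.V j) → ℙ 𝕜 S.𝔥, S.IsCurve j ψ := by
  have hgen : Generic (fun ℓ : ℙ 𝕜 (S.V j) =>
      finrank 𝕜 (LinearMap.ker (S.pairing j ℓ.rep)) = 1) := by
    obtain ⟨U, hU, hne, h⟩ := S.generic_finrank j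
    refine ⟨U, hU, hne, fun ℓ hℓ => ?_⟩
    have h1 := h ℓ hℓ
    beta_reduce at h1 ⊢
    rw [ker_pairing, ← h1, LinearEquiv.finrank_eq (Submodule.equivMapOfInjective S.φ S.injective _),
     
      Submodule.map_comap_eq_of_le inf_le_left]
  obtain ⟨ψ, h1, h2⟩ := exists_regular_extension (S.finrank_V j) (S.pairing j) hgen
  refine ⟨ψ, h1, ?_⟩
  simpa only [ker_pairing] using h2

/-- The factorization curve `ψⱼ : ℙ(Vⱼ) → ℙ(𝔥)`: the regular map that is given generically by
`ℓ ↦ φ⁻¹(φ(𝔥) ∩ Σ⁰_{j,ℓ})`. -/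
def curve (j : Fin m) : ℙ 𝕜 (S.V j) → ℙ 𝕜 S.𝔥 := Classical.choose (S.exists_isCurve j)

theorem curve_isCurve (j : Fin m) : S.IsCurve j (S.curve j) :=
  Classical.choose_spec (S.exists_isCurve j)

/-- Two factorization curves are equivalent if they have the same image. -/
def CurvesEquivalent (i j : Fin m) : Prop := Set.range (S.curve i) = Set.range (S.curve j)

/-- A factorization curve is decomposable if its equivalence class (in the set of the `m` curves
`ψ₁, …, ψₘ`, labelled by the slots) has cardinality equal to its degree. -/
def CurveDecomposable (j : Fin m) : Prop :=
  {i : Fin m | S.CurvesEquivalent i j}.ncard = degree (S.curve j)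

/-- All factorization curves are decomposable. -/
def AllCurvesDecomposable : Prop := ∀ j : Fin m, S.CurveDecomposable j

/-- The structure is of Segre-Veronese type, i.e. isomorphic to a standard Segre-Veronese
factorization structure. -/
def IsSegreVeronese : Prop :=
  ∃ D : SegreVeroneseData.{u} 𝕜 m,
    AreIsomorphic (W := fun s : Slot D.d => D.W s.1) S.φ D.inclusion

end FactorizationStructure

end FactStr

end

/-!
A point `h` of `𝔥` is a multilinear form on `V₁ × ⋯ × Vₘ`, and every point `h` of the curve `ψⱼ`
over `ℓ` vanishes as soon as its `j`th argument lies in `ℓ`: this holds for generic `ℓ`, and it is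
a polynomial identity (`pairing_curve`). As a nonzero form cannot be killed by two independent
vectors of the same slot, the curves are injective (`curve_injective`).

*The curves span `𝔥`*, decomposable or not (`iSup_linearSpan_curve`). Choose vectors `yₘ, …, y₁`
in this order, and nonzero forms `hⱼ` over `yⱼ` on the curve `ψⱼ`. Each choice of `yⱼ` can be made
such that no form chosen before becomes zero when `yⱼ` is inserted in slot `j`, since some vector
is a zero of none of finitely many nonzero linear forms. Evaluating the `hⱼ`, and one further form
that is nonzero at `(y₁, …, yₘ)`, gives a triangular matrix with nonzero diagonal, so that the
curves contain `m + 1 = dim 𝔥` independent vectors. No induction on `m` is needed.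

*A decomposable curve consists of powers* (`exists_curve_factorization`). Let `ψⱼ` be given by
forms of degree `e`, so that `ψⱼ(x)`, evaluated at `z`, is a binary form `P(z)` of degree `e` in
`x`. Let `s` be the set of slots whose curve has the same image as `ψⱼ`. For `i ∈ s` the point
`ψⱼ(x)` also lies on `ψᵢ`, so it is killed by a vector of `Vᵢ` in slot `i`. Hence `P(z)` has, in
terms of `zᵢ`, the shape `qᵢ(zᵢ) · A` with a primitive linear map `qᵢ` from `Vᵢ` to binary forms
of some degree `rᵢ`, and `rᵢ ≥ 1` because `ψⱼ` is injective. Dividing out all `qᵢ` gives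
`e ≥ ∑ rᵢ ≥ |s|`. Decomposability says `e = |s|`, so all `rᵢ` are `1`, the cofactor has degree
`0`, and `P(z) = ∏_{i ∈ s} qᵢ(zᵢ) · a(z)` with `a` independent of the slots in `s`
(`exists_factorization_of_rankOne`). The `qᵢ` identify the spaces `Vᵢ`, `i ∈ s`, with each other;
then `ψⱼ(x)` is the power `u^{⊗ |s|}` of a linear form `u` times a fixed tensor.

*Conclusion* (`isSegreVeronese`). Powers span the symmetric tensors (`symmetricTensors_eq_span`),
so the span of a class of curves is `S^d W* ⊗ Γ`, and these spaces add up to `φ(𝔥)`.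
-/

noncomputable section

namespace FactStr

/-! ### Symmetric tensors are spanned by powers -/

section Polarization
variable {K : Type w} [Field K]

/-- Polarization identity. The weights `(-1) ^ (ε k + 1)` are chosen such that, when the right
side is expanded over maps `r : Fin d → Fin d`, the coefficient of `g (x ∘ r)` is the product over
`k` of `∑ ε ∈ {0, 1}, (-1) ^ (ε + 1) * ε ^ n_k`, with `n_k` the number of preimages of `k`; the
factor is `1` if `n_k ≠ 0` and `0` otherwise. -/
lemma sum_perm_eq_sum_diagonal {U M : Type*} [AddCommGroup U] [Module K U] [AddCommGroup M]
    [Module K M] {d : ℕ} (g : MultilinearMap K (fun _ : Fin d => U) M) (x : Fin d → U) :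
    ∑ σ : Equiv.Perm (Fin d), g (x ∘ σ) =
      ∑ ε : Fin d → Fin 2, (∏ k, (-1 : K) ^ ((ε k : ℕ) + 1)) •
        g (fun _ => ∑ k, ((ε k : ℕ) : K) • x k) := by
  have h1 : ∀ ε : Fin d → Fin 2, g (fun _ => ∑ k, ((ε k : ℕ) : K) • x k) =
      ∑ r : Fin d → Fin d, (∏ k, ((ε k : ℕ) : K) ^ (Finset.univ.filter (r · = k)).card) •
        g (x ∘ r) := by
    intro ε
    rw [MultilinearMap.map_sum]
    refine Finset.sum_congr rfl fun r _ => ?_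
    rw [MultilinearMap.map_smul_univ]
    congr 1
    rw [← Finset.prod_fiberwise' Finset.univ r (fun k => ((ε k : ℕ) : K))]
    simp
  simp only [h1, Finset.smul_sum, smul_smul, ← Finset.prod_mul_distrib]
  rw [Finset.sum_comm]
  simp only [← Finset.sum_smul]
  have h2 : ∀ r : Fin d → Fin d, ∑ ε : Fin d → Fin 2,
      ∏ k, (-1 : K) ^ ((ε k : ℕ) + 1) * ((ε k : ℕ) : K) ^ (Finset.univ.filter (r · = k)).card =
      if Function.Bijective r then 1 else 0 := by
    intro r
    rw [← Fintype.prod_sum (fun (k : Fin d) (i : Fin 2) =>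
      (-1 : K) ^ ((i : ℕ) + 1) * ((i : ℕ) : K) ^ (Finset.univ.filter (r · = k)).card)]
    simp only [Fin.sum_univ_two]
    split_ifs with h
    · refine Finset.prod_eq_one fun k _ => ?_
      have : (Finset.univ.filter (r · = k)).card ≠ 0 := by
        obtain ⟨i, hi⟩ := h.2 k
        exact (Finset.card_pos.2 ⟨i, by simp [hi]⟩).ne'
      simp [this]
    · have hs : ¬ Function.Surjective r := fun hs => h (Finite.surjective_iff_bijective.1 hs)
      simp only [Function.Surjective, not_forall, not_exists] at hs
      obtain ⟨k, hk⟩ := hs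
      refine Finset.prod_eq_zero (Finset.mem_univ k) ?_
      simp [hk]
  simp only [h2, ite_smul, one_smul, zero_smul]
  rw [← Finset.sum_filter]
  refine Finset.sum_bij' (fun σ _ => (σ : Fin d → Fin d))
    (fun r hr => Equiv.ofBijective r (Finset.mem_filter.1 hr).2) ?_ ?_ ?_ ?_ ?_
  · intro σ _
    exact Finset.mem_filter.2 ⟨Finset.mem_univ _, σ.bijective⟩
  · intro r _; simp
  · intro σ _; ext; simp
  · intro r _; rfl
  · intro σ _; rfl

lemma symmetricTensors_eq_span [CharZero K] (d : ℕ) (U : Type u) [AddCommGroup U] [Module K U] :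
    symmetricTensors K d U =
      Submodule.span K (Set.range fun x : U => PiTensorProduct.tprod K fun _ : Fin d => x) := by
  apply le_antisymm
  · intro t ht
    set N := Submodule.span K (Set.range fun x : U => PiTensorProduct.tprod K fun _ : Fin d => x)
    have hsum : ∀ t : ⨂[K] _ : Fin d, U,
        ∑ σ : Equiv.Perm (Fin d), PiTensorProduct.reindex K (fun _ => U) σ t ∈ N := by
      intro t
      induction t using PiTensorProduct.induction_on with
      | smul_tprod c x =>
        simp only [map_smul, PiTensorProduct.reindex_tprod, ← Finset.smul_sum]
        refine N.smul_mem _ ?_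
        have h := sum_perm_eq_sum_diagonal (PiTensorProduct.tprod K) x
        rw [← Equiv.sum_comp (Equiv.inv (Equiv.Perm (Fin d)))] at h
        have h' : ∑ σ : Equiv.Perm (Fin d),
            PiTensorProduct.tprod K (fun i => x (σ.symm i)) ∈ N := by
          change ∑ σ : Equiv.Perm (Fin d), PiTensorProduct.tprod K (x ∘ _) ∈ N
          refine (congrArg (· ∈ N) h).mpr ?_
          exact N.sum_mem fun ε _ => N.smul_mem _ (Submodule.subset_span ⟨_, rfl⟩)
        exact h'
      | add s t hs ht =>
        simp only [map_add, Finset.sum_add_distrib]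
        exact N.add_mem hs ht
    have h := hsum t
    rw [Finset.sum_congr rfl fun σ _ => ht σ, Finset.sum_const, Finset.card_univ,
      Fintype.card_perm, Fintype.card_fin, ← Nat.cast_smul_eq_nsmul K] at h
    have hd : ((d.factorial : ℕ) : K) ≠ 0 := Nat.cast_ne_zero.2 d.factorial_ne_zero
    simpa [smul_smul, hd] using N.smul_mem ((d.factorial : ℕ) : K)⁻¹ h
  · rw [Submodule.span_le]
    rintro _ ⟨x, rfl⟩ σ
    simp

end Polarization

/-! ### Polynomials vanishing at generic points -/

section Genericity

open MvPolynomial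
variable {K : Type w} [Field K]

lemma _root_.MvPolynomial.IsHomogeneous.eval_mul_left {σ : Type*} {G : MvPolynomial σ K} {n : ℕ}
    (hG : G.IsHomogeneous n) (a : K) (x : σ → K) :
    eval (fun i => a * x i) G = a ^ n * eval x G := by
  rw [eval_eq, eval_eq, Finset.mul_sum]
  refine Finset.sum_congr rfl fun d hd => ?_
  have hdn : ∑ i ∈ d.support, d i = n := by
    have := hG (mem_support_iff.1 hd)
    simpa [Finsupp.weight_apply, Finsupp.sum] using this
  simp only [mul_pow, Finset.prod_mul_distrib, Finset.prod_pow_eq_pow_sum, hdn]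
  ring

/-- A binary polynomial that vanishes at all vectors on generic lines is zero. -/
lemma eq_zero_of_generic [Infinite K] {V : Type u} [AddCommGroup V] [Module K V]
    (b : Basis (Fin 2) K V) (P : MvPolynomial (Fin 2) K)
    (h : Generic fun ℓ : ℙ K V => ∀ x : V, x ∈ ℓ.submodule → x ≠ 0 → eval (b.repr x) P = 0) :
    P = 0 := by
  obtain ⟨U, ⟨Z, hZ, hU⟩, ⟨ℓ₀, hℓ₀⟩, hP⟩ := h
  obtain ⟨G, hG, hG0⟩ : ∃ G ∈ Z, eval (fun f : Dual K V => f ℓ₀.rep) G ≠ 0 := by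
    by_contra! hcon
    have : ℓ₀ ∈ Uᶜ := by rw [hU]; exact hcon
    exact this hℓ₀
  obtain ⟨n, hn⟩ := hZ G hG
  set G' : MvPolynomial (Fin 2) K := aeval (fun f : Dual K V => ∑ a, C (f (b a)) * X a) G with hG'
  have hev : ∀ x : V, eval (b.repr x) G' = eval (fun f : Dual K V => f x) G := by
    intro x
    rw [hG', ← coe_aeval_eq_eval, ← coe_aeval_eq_eval, RingHom.coe_coe, RingHom.coe_coe,
      ← AlgHom.comp_apply, comp_aeval]
    congr 2
    funext f
    conv_rhs => rw [← b.sum_repr x, map_sum]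
    simp [mul_comm]
  have hG'0 : G' ≠ 0 := by
    intro h0
    apply hG0
    rw [← hev, h0, map_zero]
  -- the factor `X 0` takes care of the zero vector, which lies on no point of `ℙ(V)`
  have key : P * G' * X 0 = 0 := by
    apply MvPolynomial.funext
    intro y
    rw [map_zero, map_mul, map_mul, eval_X]
    set x := b.equivFun.symm y with hx
    have hxy : (b.repr x : Fin 2 → K) = y := by
      rw [hx]; exact b.equivFun.apply_symm_apply y
    by_cases hx0 : x = 0
    · rw [← hxy, hx0]; simp
    by_cases hg : eval y G' = 0
    · simp [hg]
    have hmem : Projectivization.mk K x hx0 ∈ U := by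
      by_contra hcon
      have hc : Projectivization.mk K x hx0 ∈ Uᶜ := hcon
      rw [hU] at hc
      have h1 := hc G hG
      obtain ⟨a, ha⟩ := Projectivization.exists_smul_eq_mk_rep K x hx0
      rw [← ha] at h1
      have h2 : (fun f : Dual K V => f (a • x)) = fun f : Dual K V => (a : K) * f x := by
        funext f; simp [Units.smul_def]
      rw [h2, hn.eval_mul_left, ← hev] at h1
      rw [← hxy] at hg
      exact mul_ne_zero (pow_ne_zero _ a.ne_zero) hg h1
    have hx : x ∈ (Projectivization.mk K x hx0).submodule := by
      rw [Projectivization.submodule_mk]; exact Submodule.mem_span_singleton_self x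
    rw [← hxy, hP _ hmem x hx hx0]
    simp
  have hX : (X 0 : MvPolynomial (Fin 2) K) ≠ 0 := X_ne_zero 0
  simpa [hG'0, hX] using key

end Genericity

/-! ### Points of the factorization curves as multilinear forms -/

namespace FactorizationStructure

variable {K : Type w} [Field K] {m : ℕ} (S : FactorizationStructure.{u, v} K m)

instance (j : Fin m) : FiniteDimensional K (S.V j) :=
  Module.finite_of_finrank_pos (by rw [S.finrank_V j]; exact two_pos)

/-- The multilinear form on `V₁ × ⋯ × Vₘ` given by the tensor `φ(h)`. -/
def form : S.𝔥 →ₗ[K] MultilinearMap K S.V K :=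
  (PiTensorProduct.lift (R := K) (s := S.V) (E := K)).symm.toLinearMap ∘ₗ
    PiTensorProduct.dualDistrib ∘ₗ S.φ

lemma form_apply (h : S.𝔥) (x : ∀ i, S.V i) :
    S.form h x = PiTensorProduct.dualDistrib (S.φ h) (PiTensorProduct.tprod K x) := rfl

lemma form_injective : Function.Injective S.form :=
  (PiTensorProduct.lift (R := K) (s := S.V) (E := K)).symm.injective.comp
    ((PiTensorProduct.dualDistribEquiv (R := K) (M := S.V)).injective.comp S.injective)

lemma exists_form_ne_zero {h : S.𝔥} (hh : h ≠ 0) : ∃ x, S.form h x ≠ 0 := by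
  by_contra! hcon
  refine hh (S.form_injective ?_)
  ext x
  rw [hcon, map_zero, zero_apply]

lemma pairing_apply (j : Fin m) (y : S.V j) (h : S.𝔥) (x : ∀ i, S.V i) :
    S.pairing j y h x = S.form h (Function.update x j y) := rfl

/-- A nonzero form is killed, in each slot, by the vectors of at most one line. -/
lemma exists_smul_eq_of_pairing_eq_zero {j : Fin m} {h : S.𝔥} (hh : h ≠ 0) {y y' : S.V j}
    (hy : y ≠ 0) (h1 : S.pairing j y h = 0) (h2 : S.pairing j y' h = 0) :
    ∃ a : K, a • y = y' := by
  by_contra! hcon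
  obtain ⟨x, hx⟩ := S.exists_form_ne_zero hh
  have hli : LinearIndependent K ![y, y'] := (LinearIndependent.pair_iff' hy).2 hcon
  have hspan := hli.span_eq_top_of_card_eq_finrank' (by simp [S.finrank_V])
  have hmem : x j ∈ Submodule.span K (Set.range ![y, y']) := by rw [hspan]; trivial
  rw [Matrix.range_cons_cons_empty, Submodule.mem_span_pair] at hmem
  obtain ⟨a, c, hac⟩ := hmem
  have : S.pairing j (x j) h = 0 := by
    rw [← hac]; simp [h1, h2]
  refine hx ?_
  have h3 := congrFun this x
  rwa [pairing_apply, Function.update_eq_self] at h3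

/-- The vector of `𝔥` with the coordinates `F₀(x), F₁(x), …` with respect to the basis `finBasis`.
The binary forms `Fₖ` are evaluated at the coordinates of `x` with respect to `b`. -/
def curveVector (j : Fin m) (b : Basis (Fin 2) K (S.V j))
    (F : Fin (finrank K S.𝔥) → MvPolynomial (Fin 2) K) (x : S.V j) : S.𝔥 :=
  ∑ k, MvPolynomial.eval (b.repr x) (F k) • finBasis K S.𝔥 k

lemma exists_curve_forms (j : Fin m) :
    ∃ (b : Basis (Fin 2) K (S.V j)) (F : Fin (finrank K S.𝔥) → MvPolynomial (Fin 2) K),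
      (∀ k, (F k).IsHomogeneous (degree (S.curve j))) ∧
      ∀ (x : S.V j) (hx : x ≠ 0), (S.curve j (Projectivization.mk K x hx)).submodule =
        K ∙ S.curveVector j b F x := by
  obtain ⟨b, F, h1, -, h2⟩ : IsRegularOfDegree (S.curve j) (degree (S.curve j)) :=
    Nat.sInf_mem (S.curve_isCurve j).1
  exact ⟨b, F, h1, h2⟩

lemma exists_mem_curve (j : Fin m) (ℓ : ℙ K (S.V j)) : ∃ h ∈ (S.curve j ℓ).submodule, h ≠ 0 :=
  ⟨(S.curve j ℓ).rep, by
    rw [Projectivization.submodule_eq]; exact Submodule.mem_span_singleton_self _,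
    (S.curve j ℓ).rep_nonzero⟩

variable [Infinite K]

/-- A point of the curve `ψⱼ` over the line of `x` is killed by `x` in slot `j`. By definition of
the curve this holds for generic lines only; it extends to all lines as a polynomial identity. -/
lemma pairing_curve (j : Fin m) {x : S.V j} (hx : x ≠ 0) {h : S.𝔥}
    (hh : h ∈ (S.curve j (Projectivization.mk K x hx)).submodule) : S.pairing j x h = 0 := by
  obtain ⟨b, F, -, hF⟩ := S.exists_curve_forms j
  have key : S.pairing j x (S.curveVector j b F x) = 0 := by
    funext z
    set P : MvPolynomial (Fin 2) K := ∑ k, F k * ∑ a, MvPolynomial.X a *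
      MvPolynomial.C (S.pairing j (b a) (finBasis K S.𝔥 k) z) with hP
    have hev : ∀ y, MvPolynomial.eval (b.repr y) P =
        S.pairing j y (S.curveVector j b F y) z := by
      intro y
      have hy : ∀ k, S.pairing j y (finBasis K S.𝔥 k) z =
          ∑ a, b.repr y a * S.pairing j (b a) (finBasis K S.𝔥 k) z := by
        intro k
        conv_lhs => rw [← b.sum_repr y, map_sum, LinearMap.sum_apply, Finset.sum_apply]
        simp only [map_smul, LinearMap.smul_apply, Pi.smul_apply, smul_eq_mul]
      rw [curveVector, map_sum (S.pairing j y), Finset.sum_apply]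
      simp only [hP, map_sum, map_mul, MvPolynomial.eval_X, MvPolynomial.eval_C, map_smul,
        Pi.smul_apply, smul_eq_mul, hy]
    rw [← hev, eq_zero_of_generic b P, map_zero]; rfl
    obtain ⟨U, hU, hne, hP⟩ := (S.curve_isCurve j).2
    refine ⟨U, hU, hne, fun ℓ hℓ y hy hy0 => ?_⟩
    have h1 := hP ℓ hℓ
    have h2 : ℓ = Projectivization.mk K y hy0 := by
      rw [Projectivization.submodule_eq, Submodule.mem_span_singleton] at hy
      obtain ⟨a, ha⟩ := hy
      rw [← ℓ.mk_rep, Projectivization.mk_eq_mk_iff']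
      refine ⟨a⁻¹, ?_⟩
      rw [← ha, inv_smul_smul₀]
      rintro rfl
      exact hy0 (by rw [← ha, zero_smul])
    obtain ⟨a, ha⟩ : ∃ a : K, a • ℓ.rep = y := by
      rwa [Projectivization.submodule_eq, Submodule.mem_span_singleton] at hy
    beta_reduce at h1
    rw [← ker_pairing] at h1
    have h3 : S.curveVector j b F y ∈ (S.curve j ℓ).submodule := by
      rw [h2, hF]; exact Submodule.mem_span_singleton_self _
    rw [h1, LinearMap.mem_ker] at h3
    rw [hev]
    nth_rw 1 [← ha]
    rw [map_smul, LinearMap.smul_apply, h3, smul_zero]; rfl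
  rw [hF, Submodule.mem_span_singleton] at hh
  obtain ⟨a, rfl⟩ := hh
  rw [map_smul, key, smul_zero]

lemma curve_injective (j : Fin m) : Function.Injective (S.curve j) := by
  intro ℓ ℓ' h
  induction ℓ with | h x hx => ?_
  induction ℓ' with | h y hy => ?_
  obtain ⟨c, hc, hc0⟩ := S.exists_mem_curve j (Projectivization.mk K x hx)
  have h1 := S.pairing_curve j hx hc
  rw [h] at hc
  have h2 := S.pairing_curve j hy hc
  rw [Projectivization.mk_eq_mk_iff']
  exact S.exists_smul_eq_of_pairing_eq_zero hc0 hy h2 h1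

lemma exists_killed_mem_linearSpan (j : Fin m) {y : S.V j} (hy : y ≠ 0) :
    ∃ h ∈ linearSpan (S.curve j), h ≠ 0 ∧ S.pairing j y h = 0 := by
  obtain ⟨h, hh, h0⟩ := S.exists_mem_curve j (Projectivization.mk K y hy)
  exact ⟨h, le_iSup (fun ℓ => (S.curve j ℓ).submodule) _ hh, h0, S.pairing_curve j hy hh⟩

/-- Vectors `yⱼ` for `j ≥ k`, and forms `hᵢ` for `i ≥ k`, chosen by descending `k`, such that `hⱼ`
is killed by `yⱼ` in slot `j`, while `hᵢ` is nonzero at a point `xᵢ` whose coordinates of index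
`k ≤ j < i` are `yⱼ`. The form `hₘ`, which has the index `Fin.last m`, belongs to no slot. -/
lemma exists_triangular_system (hm : 1 ≤ m) (k : ℕ) (hk : k ≤ m) :
    ∃ (y : ∀ i, S.V i) (h : Fin (m + 1) → S.𝔥) (x : Fin (m + 1) → ∀ i, S.V i),
      ∀ i : Fin (m + 1), k ≤ i → h i ∈ ⨆ j, linearSpan (S.curve j) ∧
        (∀ j : Fin m, j.castSucc = i → S.pairing j (y j) (h i) = 0) ∧
        (∀ j : Fin m, k ≤ j → j.castSucc < i → x i j = y j) ∧ S.form (h i) (x i) ≠ 0 := by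
  induction hk using Nat.decreasingInduction with
  | self =>
    have j₀ : Fin m := ⟨0, hm⟩
    have : Nontrivial (S.V j₀) := Module.nontrivial_of_finrank_pos (R := K) (by simp [S.finrank_V])
    obtain ⟨y₀, hy₀⟩ := exists_ne (0 : S.V j₀)
    obtain ⟨h, hh, h0, -⟩ := S.exists_killed_mem_linearSpan j₀ hy₀
    obtain ⟨x, hx⟩ := S.exists_form_ne_zero h0
    refine ⟨0, fun _ => h, fun _ => x, fun i hi => ⟨?_, ?_, ?_, hx⟩⟩
    · exact le_iSup (fun j => linearSpan (S.curve j)) j₀ hh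
    · rintro j rfl
      have := j.2
      simp only [Fin.val_castSucc] at hi
      omega
    · intro j hj
      have := j.2
      omega
  | of_succ k hk ih =>
    obtain ⟨y, h, x, ih⟩ := ih
    let j : Fin m := ⟨k, hk⟩
    -- a vector for slot `k` at which none of the forms already chosen vanishes
    obtain ⟨v, hv⟩ : ∃ v : S.V j, ∀ i : {i : Fin (m + 1) // k + 1 ≤ (i : ℕ)},
        (S.form (h i)).toLinearMap (x i) j v ≠ 0 := by
      refine Module.Dual.exists_forall_ne_zero_of_forall_exists
        (fun i : {i : Fin (m + 1) // k + 1 ≤ (i : ℕ)} => (S.form (h i)).toLinearMap (x i) j)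
        fun i => ⟨x i j, ?_⟩
      simpa using (ih i i.2).2.2.2
    -- the index `Fin.last m` is always among those already treated
    have hv0 : v ≠ 0 := by
      rintro rfl
      exact hv ⟨Fin.last m, by simpa using hk⟩ (map_zero _)
    obtain ⟨h', hh', h0', hk'⟩ := S.exists_killed_mem_linearSpan j hv0
    obtain ⟨x', hx'⟩ := S.exists_form_ne_zero h0'
    refine ⟨Function.update y j v, Function.update h j.castSucc h',
      Function.update (fun i => Function.update (x i) j v) j.castSucc x', fun i hi => ?_⟩
    by_cases hij : i = j.castSucc
    · subst hij
      simp only [Function.update_self]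
      refine ⟨le_iSup (fun j => linearSpan (S.curve j)) j hh', ?_, ?_, hx'⟩
      · intro j' hj'
        obtain rfl : j' = j := Fin.castSucc_injective _ hj'
        simpa using hk'
      · intro j' hj' hlt
        have : (j' : ℕ) < k := hlt
        omega
    · have hi' : k + 1 ≤ i := by
        have : (i : ℕ) ≠ k := fun h => hij (Fin.ext h)
        omega
      obtain ⟨h1, h2, h3, -⟩ := ih i hi'
      rw [Function.update_of_ne hij, Function.update_of_ne hij]
      refine ⟨h1, ?_, ?_, hv ⟨i, hi'⟩⟩
      · rintro j' rfl
        have : j' ≠ j := by rintro rfl; exact hij rfl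
        rw [Function.update_of_ne this]
        exact h2 j' rfl
      · intro j' hj' hlt
        by_cases hjj : j' = j
        · subst hjj; simp
        · rw [Function.update_of_ne hjj, Function.update_of_ne hjj]
          refine h3 j' ?_ hlt
          have : (j' : ℕ) ≠ k := fun h => hjj (Fin.ext h)
          omega

/-- The factorization curves of any factorization structure span `𝔥`. -/
theorem iSup_linearSpan_curve (hm : 1 ≤ m) : ⨆ j, linearSpan (S.curve j) = ⊤ := by
  obtain ⟨y, h, x, H⟩ := S.exists_triangular_system hm 0 (Nat.zero_le m)
  set A : Matrix (Fin (m + 1)) (Fin (m + 1)) K := fun i i' => S.form (h i') (x i) with hA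
  have htri : A.BlockTriangular id := by
    intro i i' hlt
    have hlt' : i' < i := hlt
    obtain ⟨j, rfl⟩ : ∃ j : Fin m, j.castSucc = i' :=
      Fin.exists_castSucc_eq.2 (Fin.ne_last_of_lt hlt')
    have h1 := congrFun ((H j.castSucc (Nat.zero_le _)).2.1 j rfl) (x i)
    rwa [pairing_apply, ← (H i (Nat.zero_le _)).2.2.1 j (Nat.zero_le _) hlt',
      Function.update_eq_self] at h1
  have hdet : A.det ≠ 0 := by
    rw [Matrix.det_of_isUpperTriangular htri]
    exact Finset.prod_ne_zero_iff.2 fun i _ => (H i (Nat.zero_le _)).2.2.2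
  have hli : LinearIndependent K h := by
    rw [Fintype.linearIndependent_iff]
    intro c hc
    have h1 : A.mulVec c = 0 := by
      ext i
      have := congrArg (fun t => S.form t (x i)) hc
      simpa [hA, Matrix.mulVec, dotProduct, mul_comm, sum_apply] using this
    exact congrFun (Matrix.eq_zero_of_mulVec_eq_zero hdet h1)
  rw [eq_top_iff, ← hli.span_eq_top_of_card_eq_finrank (by simp [S.finrank_𝔥]),
    Submodule.span_le]
  rintro _ ⟨i, rfl⟩
  exact (H i (Nat.zero_le _)).1

end FactorizationStructure

/-! ### Multilinear maps to binary forms that have rank one in some slots -/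

section RankOne

open MvPolynomial
variable {K : Type w} [Field K]

/-- Two binary forms of the same degree, not both zero, are proportional to two coprime forms,
again of one degree `r`: take a proportional pair of least degree. -/
lemma exists_isRelPrime_forms {p₀ p₁ : MvPolynomial (Fin 2) K} {e : ℕ} (h₀ : p₀.IsHomogeneous e)
    (h₁ : p₁.IsHomogeneous e) (hp : p₀ ≠ 0 ∨ p₁ ≠ 0) :
    ∃ (r : ℕ) (q₀ q₁ : MvPolynomial (Fin 2) K), q₀.IsHomogeneous r ∧ q₁.IsHomogeneous r ∧
      (q₀ ≠ 0 ∨ q₁ ≠ 0) ∧ p₀ * q₁ = p₁ * q₀ ∧ IsRelPrime q₀ q₁ := by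
  classical
  have hex : ∃ (r : ℕ) (q₀ q₁ : MvPolynomial (Fin 2) K), q₀.IsHomogeneous r ∧
      q₁.IsHomogeneous r ∧ (q₀ ≠ 0 ∨ q₁ ≠ 0) ∧ p₀ * q₁ = p₁ * q₀ :=
    ⟨e, p₀, p₁, h₀, h₁, hp, mul_comm _ _⟩
  obtain ⟨q₀, q₁, hq₀, hq₁, hq, hpq⟩ := Nat.find_spec hex
  refine ⟨_, q₀, q₁, hq₀, hq₁, hq, hpq, fun g hg₀ hg₁ => ?_⟩
  have hg : g ≠ 0 := by
    rintro rfl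
    exact hq.elim (fun h => h (zero_dvd_iff.1 hg₀)) (fun h => h (zero_dvd_iff.1 hg₁))
  obtain ⟨f₀, hf₀, e₀⟩ := exists_homogeneous_quotient hq₀ hg₀
  obtain ⟨f₁, hf₁, e₁⟩ := exists_homogeneous_quotient hq₁ hg₁
  set t := homogeneousComponent g.totalDegree g with ht
  have ht0 : t ≠ 0 := by
    intro h
    rw [h, zero_mul] at e₀ e₁
    exact hq.elim (fun h => h e₀) (fun h => h e₁)
  have hle : g.totalDegree ≤ Nat.find hex := by
    rcases hq with h | h
    · obtain ⟨f, hf⟩ := hg₀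
      have hf0 : f ≠ 0 := by rintro rfl; exact h (by rw [hf, mul_zero])
      rw [← hq₀.totalDegree h, hf, totalDegree_mul_of_isDomain hg hf0]
      omega
    · obtain ⟨f, hf⟩ := hg₁
      have hf0 : f ≠ 0 := by rintro rfl; exact h (by rw [hf, mul_zero])
      rw [← hq₁.totalDegree h, hf, totalDegree_mul_of_isDomain hg hf0]
      omega
  have hmin : Nat.find hex ≤ Nat.find hex - g.totalDegree := by
    refine Nat.find_min' hex ⟨f₀, f₁, hf₀, hf₁, ?_, mul_left_cancel₀ ht0 ?_⟩
    · exact hq.imp (fun h h' => h (by rw [e₀, h', mul_zero]))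
        (fun h h' => h (by rw [e₁, h', mul_zero]))
    · calc t * (p₀ * f₁) = p₀ * (t * f₁) := by ring
        _ = p₁ * (t * f₀) := by rw [← e₀, ← e₁, hpq]
        _ = t * (p₁ * f₀) := by ring
  have hdeg : g.totalDegree = 0 := by
    by_contra hne
    have hpos : 0 < Nat.find hex := lt_of_lt_of_le (Nat.pos_of_ne_zero hne) hle
    omega
  rw [totalDegree_eq_zero_iff_eq_C] at hdeg
  rw [hdeg]
  refine (IsUnit.mk0 _ fun h' => hg ?_).map C
  rw [hdeg, h', map_zero]

lemma exists_eq_mul_of_isRelPrime {R : Type*} [CommRing R] [IsDomain R] [DecompositionMonoid R]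
    {q₀ q₁ a₀ a₁ : R} (hq : IsRelPrime q₀ q₁) (h : a₀ * q₁ = a₁ * q₀) :
    ∃ c, a₀ = q₀ * c ∧ a₁ = q₁ * c := by
  by_cases h0 : q₀ = 0
  · subst h0
    obtain ⟨u, hu⟩ := hq (dvd_zero _) dvd_rfl
    rw [mul_zero] at h
    have ha : a₀ = 0 := by
      rcases mul_eq_zero.1 h with h | h
      · exact h
      · rw [← hu] at h; exact absurd h u.ne_zero
    refine ⟨↑u⁻¹ * a₁, by rw [ha, zero_mul], ?_⟩
    rw [← hu, ← mul_assoc, Units.mul_inv, one_mul]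
  · obtain ⟨c, hc⟩ : q₀ ∣ a₀ := hq.dvd_of_dvd_mul_right ⟨a₁, by rw [h, mul_comm]⟩
    refine ⟨c, hc, mul_left_cancel₀ h0 ?_⟩
    rw [mul_comm q₀ a₁, ← h, hc]; ring

/-- A nonzero linear map `L` from a plane to binary forms of a fixed degree is a multiple of a
primitive one: a map `q`, into forms of degree `r`, such that every linear map proportional to `q`
is a polynomial multiple of `q`. If `r = 0`, then `q` has values in a line and is not
injective. -/
lemma exists_primitive_linearMap {U : Type*} [AddCommGroup U] [Module K U] (hU : finrank K U = 2)
    (L : U →ₗ[K] MvPolynomial (Fin 2) K) {e : ℕ} (hL : ∀ y, (L y).IsHomogeneous e) (hL0 : L ≠ 0) :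
    ∃ (r : ℕ) (q : U →ₗ[K] MvPolynomial (Fin 2) K), (∀ y, (q y).IsHomogeneous r) ∧
      (∃ y, q y ≠ 0) ∧ (∀ y y', L y * q y' = L y' * q y) ∧
      (∀ A : U →ₗ[K] MvPolynomial (Fin 2) K, (∀ y y', A y * q y' = A y' * q y) →
        ∃ c, ∀ y, A y = q y * c) ∧
      (r = 0 → ∃ y ≠ 0, q y = 0) := by
  have : FiniteDimensional K U := Module.finite_of_finrank_pos (by omega)
  let b : Basis (Fin 2) K U := finBasisOfFinrankEq K U hU
  have hexp : ∀ (A : U →ₗ[K] MvPolynomial (Fin 2) K) (y : U),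
      A y = b.repr y 0 • A (b 0) + b.repr y 1 • A (b 1) := by
    intro A y
    conv_lhs => rw [← b.sum_repr y, map_sum, Fin.sum_univ_two, map_smul, map_smul]
  have hp : L (b 0) ≠ 0 ∨ L (b 1) ≠ 0 := by
    by_contra! hcon
    refine hL0 (LinearMap.ext fun y => ?_)
    rw [hexp, hcon.1, hcon.2]; simp
  obtain ⟨r, q₀, q₁, hq₀, hq₁, hq, hpq, hrel⟩ := exists_isRelPrime_forms (hL (b 0)) (hL (b 1)) hp
  let q : U →ₗ[K] MvPolynomial (Fin 2) K := b.constr K ![q₀, q₁]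
  have hb0 : q (b 0) = q₀ := by simp [q]
  have hb1 : q (b 1) = q₁ := by simp [q]
  have hqy : ∀ y, (q y).IsHomogeneous r := by
    intro y
    rw [hexp q, hb0, hb1, smul_eq_C_mul, smul_eq_C_mul]
    exact (hq₀.C_mul _).add (hq₁.C_mul _)
  refine ⟨r, q, hqy, ?_, ?_, ?_, ?_⟩
  · exact hq.elim (fun h => ⟨b 0, by rwa [hb0]⟩) (fun h => ⟨b 1, by rwa [hb1]⟩)
  · intro y y'
    rw [hexp q y, hexp q y', hexp L y, hexp L y', hb0, hb1]
    simp only [smul_eq_C_mul]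
    linear_combination (C (b.repr y 0) * C (b.repr y' 1) - C (b.repr y 1) * C (b.repr y' 0)) * hpq
  · intro A hA
    obtain ⟨c, h0, h1⟩ := exists_eq_mul_of_isRelPrime hrel
      (show A (b 0) * q₁ = A (b 1) * q₀ by rw [← hb0, ← hb1, hA])
    refine ⟨c, fun y => ?_⟩
    rw [hexp A, hexp q, h0, h1, hb0, hb1]
    simp only [smul_eq_C_mul]; ring
  · rintro rfl
    have hker : LinearMap.ker (lcoeff K (0 : Fin 2 →₀ ℕ) ∘ₗ q) ≠ ⊥ :=
      LinearMap.ker_ne_bot_of_finrank_lt (by simp [hU])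
    obtain ⟨y, hy, hy0⟩ := (Submodule.ne_bot_iff _).1 hker
    refine ⟨y, hy0, ?_⟩
    have h1 : coeff 0 (q y) = 0 := hy
    rcases eq_or_ne (q y) 0 with h | h
    · exact h
    · have := (hqy y).totalDegree h
      rw [totalDegree_eq_zero_iff_eq_C] at this
      rw [this, h1, map_zero]

variable {ι : Type*} [DecidableEq ι] {V : ι → Type u} [∀ i, AddCommGroup (V i)]
  [∀ i, Module K (V i)]

/-- The primitive linear maps of different slots need not take coprime values, so they are divided
out one after the other; the quotient stays linear in the slots not yet treated. -/
lemma prod_dvd_of_rankOne (P : MultilinearMap K V (MvPolynomial (Fin 2) K))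
    (q : ∀ i, V i →ₗ[K] MvPolynomial (Fin 2) K) (s : Finset ι)
    (hP : ∀ i ∈ s, ∀ z y y', P (Function.update z i y) * q i y' =
      P (Function.update z i y') * q i y)
    (hq : ∀ i ∈ s, ∀ A : V i →ₗ[K] MvPolynomial (Fin 2) K,
      (∀ y y', A y * q i y' = A y' * q i y) → ∃ c, ∀ y, A y = q i y * c) (z : ∀ i, V i) :
    ∏ i ∈ s, q i (z i) ∣ P z := by
  induction s using Finset.induction_on generalizing z with
  | empty => simp
  | insert i s hi ih =>
    have ih' : ∀ z, ∏ k ∈ s, q k (z k) ∣ P z := ih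
      (fun k hk => hP k (Finset.mem_insert_of_mem hk))
      (fun k hk => hq k (Finset.mem_insert_of_mem hk))
    rw [Finset.prod_insert hi]
    set Q := ∏ k ∈ s, q k (z k) with hQ
    -- if the product is nonzero, it can be cancelled, and the quotient is linear in slot `i`
    by_cases hQ0 : Q = 0
    · have h := ih' z
      rw [← hQ, hQ0, zero_dvd_iff] at h
      rw [h]; exact dvd_zero _
    have hdvd : ∀ y, ∃ a, P (Function.update z i y) = Q * a := by
      intro y
      have h := ih' (Function.update z i y)
      rwa [Finset.prod_congr rfl fun k hk => by
        rw [Function.update_of_ne (ne_of_mem_of_not_mem hk hi)]] at h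
    choose A hA using hdvd
    let A' : V i →ₗ[K] MvPolynomial (Fin 2) K :=
      { toFun := A
        map_add' := fun y y' => mul_left_cancel₀ hQ0 (by
          rw [mul_add, ← hA, ← hA, ← hA, MultilinearMap.map_update_add])
        map_smul' := fun t y => mul_left_cancel₀ hQ0 (by
          rw [RingHom.id_apply, mul_smul_comm, ← hA, ← hA, MultilinearMap.map_update_smul]) }
    obtain ⟨c, hc⟩ := hq i (Finset.mem_insert_self _ _) A' fun y y' => mul_left_cancel₀ hQ0 (by
      change Q * (A y * q i y') = Q * (A y' * q i y)
      rw [← mul_assoc, ← mul_assoc, ← hA, ← hA, hP i (Finset.mem_insert_self _ _)])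
    refine ⟨c, ?_⟩
    have h1 : A (z i) = q i (z i) * c := hc (z i)
    have h2 := hA (z i)
    rw [Function.update_eq_self, h1] at h2
    rw [h2]; ring

/-- Replacing the arguments `zᵢ` in the slots of `s` by `z₀ᵢ` multiplies `P(z)` by
`∏ qᵢ(z₀ᵢ) / ∏ qᵢ(zᵢ)`. -/
lemma prod_mul_eq_prod_mul_piecewise (P : MultilinearMap K V (MvPolynomial (Fin 2) K))
    (q : ∀ i, V i →ₗ[K] MvPolynomial (Fin 2) K) (s : Finset ι)
    (hP : ∀ i ∈ s, ∀ z y y', P (Function.update z i y) * q i y' =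
      P (Function.update z i y') * q i y) (z₀ z : ∀ i, V i) :
    (∏ i ∈ s, q i (z₀ i)) * P z = (∏ i ∈ s, q i (z i)) * P (s.piecewise z₀ z) := by
  induction s using Finset.induction_on with
  | empty => simp
  | insert i s hi ih =>
    have ih' := ih fun k hk => hP k (Finset.mem_insert_of_mem hk)
    rw [Finset.prod_insert hi, Finset.prod_insert hi, Finset.piecewise_insert, mul_assoc, ih']
    have h := hP i (Finset.mem_insert_self _ _) (s.piecewise z₀ z) (z i) (z₀ i)
    have h2 : Function.update (s.piecewise z₀ z) i (z i) = s.piecewise z₀ z := by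
      rw [Function.update_eq_self_iff, Finset.piecewise_eq_of_notMem _ _ _ hi]
    rw [h2] at h
    linear_combination (∏ k ∈ s, q k (z k)) * h

/-- Let `P` be a multilinear map to binary forms of degree `|s|` that has rank one in each slot
`i ∈ s`, in the sense that `y ↦ P(…, y, …)` depends on the other arguments only up to a factor,
and that is nondegenerate in these slots. Then `P` is a product of linear maps `qᵢ` to binary
linear forms, one for each slot in `s`, and of a scalar function of the remaining arguments. -/
theorem exists_factorization_of_rankOne (s : Finset ι) (hV : ∀ i ∈ s, finrank K (V i) = 2)
    (P : MultilinearMap K V (MvPolynomial (Fin 2) K)) (hP0 : P ≠ 0)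
    (hhom : ∀ z, (P z).IsHomogeneous s.card)
    (hrank : ∀ i ∈ s, ∀ z z' y y', P (Function.update z i y) * P (Function.update z' i y') =
      P (Function.update z i y') * P (Function.update z' i y))
    (hnd : ∀ i ∈ s, ∀ y ≠ 0, ∃ z, P (Function.update z i y) ≠ 0) :
    ∃ (q : ∀ i, V i →ₗ[K] MvPolynomial (Fin 2) K) (a : (∀ i, V i) → K),
      (∀ i ∈ s, (∀ y, (q i y).IsHomogeneous 1) ∧ Function.Injective (q i)) ∧
      (∀ z, P z = (∏ i ∈ s, q i (z i)) * C (a z)) ∧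
      ∀ z z', (∀ i ∉ s, z i = z' i) → a z = a z' := by
  obtain ⟨z₀, hz₀⟩ : ∃ z, P z ≠ 0 := by
    by_contra! hcon
    exact hP0 (MultilinearMap.ext hcon)
  have hslot : ∀ i, ∃ (r : ℕ) (q : V i →ₗ[K] MvPolynomial (Fin 2) K), i ∈ s →
      1 ≤ r ∧ (∀ y, (q y).IsHomogeneous r) ∧
      (∀ z y y', P (Function.update z i y) * q y' = P (Function.update z i y') * q y) ∧
      (∀ A : V i →ₗ[K] MvPolynomial (Fin 2) K, (∀ y y', A y * q y' = A y' * q y) →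
        ∃ c, ∀ y, A y = q y * c) := by
    intro i
    by_cases hi : i ∈ s
    swap
    · exact ⟨0, 0, fun h => absurd h hi⟩
    have hL0 : P.toLinearMap z₀ i ≠ 0 := by
      intro h
      have := LinearMap.congr_fun h (z₀ i)
      simp [hz₀] at this
    obtain ⟨r, q, hq, ⟨w, hw⟩, hLq, hdiv, hr⟩ :=
      exists_primitive_linearMap (hV i hi) (P.toLinearMap z₀ i) (fun y => hhom _) hL0
    have hswap : ∀ z y y',
        P (Function.update z i y) * q y' = P (Function.update z i y') * q y := by
      intro z y y'
      have h1 := hrank i hi z z₀ y (z₀ i)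
      have h2 := hrank i hi z z₀ y' (z₀ i)
      have h3 : P (Function.update z₀ i y) * q y' = P (Function.update z₀ i y') * q y := hLq y y'
      rw [Function.update_eq_self] at h1 h2
      refine mul_right_cancel₀ hz₀ ?_
      linear_combination q y' * h1 - q y * h2 + P (Function.update z i (z₀ i)) * h3
    refine ⟨r, q, fun _ => ⟨?_, hq, hswap, hdiv⟩⟩
    -- if `r = 0`, some `y ≠ 0` with `q y = 0` makes `P` vanish identically
    by_contra! hr0
    obtain ⟨y, hy, hqy⟩ := hr (by omega)
    obtain ⟨z, hz⟩ := hnd i hi y hy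
    refine (mul_ne_zero hz hw) ?_
    rw [hswap, hqy, mul_zero]
  choose r q hrq using hslot
  have hdvd : ∀ z, ∏ i ∈ s, q i (z i) ∣ P z := fun z =>
    prod_dvd_of_rankOne P q s (fun i hi => (hrq i hi).2.2.1) (fun i hi => (hrq i hi).2.2.2) z
  have hdeg : ∀ z B, P z = (∏ i ∈ s, q i (z i)) * B → P z ≠ 0 →
      ∑ i ∈ s, r i + B.totalDegree = s.card := by
    intro z B hB hz
    rw [hB] at hz
    have hQ := left_ne_zero_of_mul hz
    have h1 : (∏ i ∈ s, q i (z i)).IsHomogeneous (∑ i ∈ s, r i) :=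
      IsHomogeneous.prod _ _ _ fun i hi => (hrq i hi).2.1 _
    rw [← h1.totalDegree hQ, ← totalDegree_mul_of_isDomain hQ (right_ne_zero_of_mul hz), ← hB]
    exact (hhom z).totalDegree (by rw [hB]; exact hz)
  -- counting degrees: `|s| = ∑ rᵢ + deg B` with all `rᵢ ≥ 1`
  have hle : s.card ≤ ∑ i ∈ s, r i := by
    rw [Finset.card_eq_sum_ones]
    exact Finset.sum_le_sum fun i hi => (hrq i hi).1
  have hr1 : ∀ i ∈ s, r i = 1 := by
    obtain ⟨B, hB⟩ := hdvd z₀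
    have h1 := hdeg z₀ B hB hz₀
    have h2 : ∑ i ∈ s, 1 = ∑ i ∈ s, r i := by
      rw [← Finset.card_eq_sum_ones]; omega
    exact fun i hi => ((Finset.sum_eq_sum_iff_of_le fun i hi => (hrq i hi).1).1 h2 i hi).symm
  have hconst : ∀ z, ∃ c : K, P z = (∏ i ∈ s, q i (z i)) * C c := by
    intro z
    by_cases hz : P z = 0
    · exact ⟨0, by rw [hz, map_zero, mul_zero]⟩
    obtain ⟨B, hB⟩ := hdvd z
    have h1 := hdeg z B hB hz
    have h2 : B.totalDegree = 0 := by omega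
    rw [totalDegree_eq_zero_iff_eq_C] at h2
    exact ⟨_, h2 ▸ hB⟩
  choose a ha using hconst
  have hQ0 : ∏ i ∈ s, q i (z₀ i) ≠ 0 := by
    rw [ha] at hz₀
    exact left_ne_zero_of_mul hz₀
  -- fixing the arguments in `s` makes the scalar visibly independent of them
  refine ⟨q, fun z => a (s.piecewise z₀ z), fun i hi => ⟨?_, ?_⟩, ?_, ?_⟩
  · rw [← hr1 i hi]
    exact (hrq i hi).2.1
  · rw [injective_iff_map_eq_zero]
    intro y hy
    by_contra hy0
    obtain ⟨z, hz⟩ := hnd i hi y hy0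
    refine hz ?_
    rw [ha, Finset.prod_eq_zero hi, zero_mul]
    rwa [Function.update_self]
  · intro z
    refine mul_left_cancel₀ hQ0 ?_
    rw [prod_mul_eq_prod_mul_piecewise P q s (fun i hi => (hrq i hi).2.2.1) z₀ z,
      ha (s.piecewise z₀ z)]
    have : ∏ i ∈ s, q i (s.piecewise z₀ z i) = ∏ i ∈ s, q i (z₀ i) :=
      Finset.prod_congr rfl fun i hi => by rw [Finset.piecewise_eq_of_mem _ _ _ hi]
    rw [this]; ring
  · intro z z' h
    refine congrArg a (funext fun i => ?_)
    by_cases hi : i ∈ s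
    · rw [Finset.piecewise_eq_of_mem _ _ _ hi, Finset.piecewise_eq_of_mem _ _ _ hi]
    · rw [Finset.piecewise_eq_of_notMem _ _ _ hi, Finset.piecewise_eq_of_notMem _ _ _ hi, h i hi]

end RankOne

/-! ### Factorization of decomposable curves -/

section LinearForms

open MvPolynomial
variable {K : Type w} [Field K]

/-- Homogeneous polynomials of degree one as linear forms. The linear map is defined on all
polynomials, by their coefficients of degree one. -/
lemma exists_linearForm {V : Type u} [AddCommGroup V] [Module K V] (b : Basis (Fin 2) K V) :
    ∃ D : MvPolynomial (Fin 2) K →ₗ[K] Dual K V,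
      ∀ F : MvPolynomial (Fin 2) K, F.IsHomogeneous 1 → ∀ x, D F x = eval (b.repr x) F := by
  refine ⟨∑ a, (lcoeff K (Finsupp.single a 1)).smulRight (b.coord a), fun F hF x => ?_⟩
  replace hF : F ∈ Submodule.span K (Set.range (X : Fin 2 → MvPolynomial (Fin 2) K)) := by
    rw [← homogeneousSubmodule_one_eq_span_X]; exact hF
  induction hF using Submodule.span_induction with
  | mem F h =>
    obtain ⟨i, rfl⟩ := h
    fin_cases i <;> simp [coeff_X, Finsupp.single_left_inj]
  | zero => simp
  | add F G _ _ h1 h2 => rw [map_add, map_add, LinearMap.add_apply, h1, h2]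
  | smul t F _ h => rw [map_smul, smul_eval, LinearMap.smul_apply, h, smul_eq_mul]

lemma mul_eq_mul_of_common_kernel {U : Type*} [AddCommGroup U] [Module K U]
    (hU : finrank K U = 2) (f g : Dual K U) {y₀ : U} (hy₀ : y₀ ≠ 0) (hf : f y₀ = 0)
    (hg : g y₀ = 0) (y y' : U) : f y * g y' = f y' * g y := by
  have : FiniteDimensional K U := Module.finite_of_finrank_pos (by omega)
  by_cases h : ∃ t : K, t • y₀ = y
  · obtain ⟨t, rfl⟩ := h
    simp [hf, hg]
  push Not at h
  have hli : LinearIndependent K ![y₀, y] := (LinearIndependent.pair_iff' hy₀).2 h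
  have hspan := hli.span_eq_top_of_card_eq_finrank' (by simp [hU])
  have hmem : y' ∈ Submodule.span K (Set.range ![y₀, y]) := by rw [hspan]; trivial
  rw [Matrix.range_cons_cons_empty, Submodule.mem_span_pair] at hmem
  obtain ⟨s, t, rfl⟩ := hmem
  simp [hf, hg]
  ring

end LinearForms

namespace FactorizationStructure

open MvPolynomial
variable {K : Type w} [Field K] {m : ℕ} (S : FactorizationStructure.{u, v} K m)

/-- The value at `z` of the form `curveVector j b F x`, as a binary form in the coordinates of
`x`; it is multilinear in `z`. -/
def formPolynomial (F : Fin (finrank K S.𝔥) → MvPolynomial (Fin 2) K) :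
    MultilinearMap K S.V (MvPolynomial (Fin 2) K) :=
  ∑ k, (LinearMap.toSpanSingleton K _ (F k)).compMultilinearMap (S.form (finBasis K S.𝔥 k))

lemma formPolynomial_apply (F : Fin (finrank K S.𝔥) → MvPolynomial (Fin 2) K)
    (z : ∀ i, S.V i) :
    S.formPolynomial F z = ∑ k, S.form (finBasis K S.𝔥 k) z • F k := by
  simp [formPolynomial, sum_apply]

lemma eval_formPolynomial (j : Fin m) (b : Basis (Fin 2) K (S.V j))
    (F : Fin (finrank K S.𝔥) → MvPolynomial (Fin 2) K) (x : S.V j) (z : ∀ i, S.V i) :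
    eval (b.repr x) (S.formPolynomial F z) = S.form (S.curveVector j b F x) z := by
  simp [formPolynomial_apply, curveVector, sum_apply, mul_comm]

variable [Infinite K]

open Classical in
/-- A decomposable curve `ψⱼ` is given by vectors `c x` whose forms split off one linear form for
each slot `i` with an equivalent curve. This linear form is given by an isomorphism `T i` from
`Vᵢ` to the dual of `Vⱼ`. The cofactor does not depend on `x`, and only on the arguments in the
other slots. -/
theorem exists_curve_factorization (j : Fin m) (hj : S.CurveDecomposable j) :
    ∃ (c : S.V j → S.𝔥) (T : ∀ i, S.V i →ₗ[K] Dual K (S.V j)) (a : (∀ i, S.V i) → K),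
      (∀ i, S.CurvesEquivalent i j → Function.Bijective (T i)) ∧
      (∀ x hx, (S.curve j (Projectivization.mk K x hx)).submodule = K ∙ c x) ∧
      (∀ x z, S.form (c x) z =
        (∏ i with S.CurvesEquivalent i j, T i (z i) x) * a z) ∧
      ∀ z z', (∀ i, ¬ S.CurvesEquivalent i j → z i = z' i) → a z = a z' := by
  obtain ⟨b, F, hF, hcurve⟩ := S.exists_curve_forms j
  set c := S.curveVector j b F with hc
  set s : Finset (Fin m) := Finset.univ.filter fun i => S.CurvesEquivalent i j with hs
  have hmem : ∀ i, i ∈ s ↔ S.CurvesEquivalent i j := by simp [hs]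
  have hcard : s.card = degree (S.curve j) := by
    rw [← hj, ← Set.ncard_coe_finset]
    congr 1
    ext i; simp [hs]
  have hcard0 : s.card ≠ 0 := Finset.card_ne_zero_of_mem ((hmem j).2 rfl)
  have hc0 : ∀ x, x ≠ 0 → c x ≠ 0 := by
    intro x hx h0
    obtain ⟨h, hh, hne⟩ := S.exists_mem_curve j (Projectivization.mk K x hx)
    rw [hcurve, h0, Submodule.span_zero_singleton] at hh
    exact hne hh
  have hcmem : ∀ x (hx : x ≠ 0), c x ∈ (S.curve j (Projectivization.mk K x hx)).submodule := by
    intro x hx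
    rw [hcurve]; exact Submodule.mem_span_singleton_self _
  -- the point `ψⱼ(x)` lies on `ψᵢ` as well, hence some vector kills it in slot `i`
  have hkill : ∀ i ∈ s, ∀ x (hx : x ≠ 0), ∃ (y : S.V i) (hy : y ≠ 0),
      S.curve j (Projectivization.mk K x hx) = S.curve i (Projectivization.mk K y hy) ∧
      S.pairing i y (c x) = 0 := by
    intro i hi x hx
    have hi' : Set.range (S.curve i) = Set.range (S.curve j) := (hmem i).1 hi
    obtain ⟨ℓ, hℓ⟩ : S.curve j (Projectivization.mk K x hx) ∈ Set.range (S.curve i) := by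
      rw [hi']; exact ⟨_, rfl⟩
    induction ℓ with | h y hy => ?_
    refine ⟨y, hy, hℓ.symm, S.pairing_curve i hy ?_⟩
    rw [hℓ]; exact hcmem x hx
  have hpoint : ∀ p : Fin 2 → K, ∃ x : S.V j, (b.repr x : Fin 2 → K) = p := fun p =>
    ⟨b.equivFun.symm p, b.equivFun.apply_symm_apply p⟩
  set P := S.formPolynomial F with hPdef
  have hev : ∀ x z, eval (b.repr x) (P z) = S.form (c x) z := S.eval_formPolynomial j b F
  have hhom : ∀ z, (P z).IsHomogeneous s.card := by
    intro z
    rw [hPdef, formPolynomial_apply, hcard]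
    refine IsHomogeneous.sum _ _ _ fun k _ => ?_
    rw [smul_eq_C_mul]
    exact (hF k).C_mul _
  have hzero : ∀ z, eval (b.repr (0 : S.V j)) (P z) = 0 := by
    intro z
    have h := (hhom z).eval_mul_left 0 (b.repr (0 : S.V j))
    rw [zero_pow hcard0, zero_mul] at h
    rw [← h]; congr 2; ext i; simp
  have hb0 : b 0 ≠ 0 := b.ne_zero 0
  obtain ⟨q, a, hq, hPq, ha⟩ := exists_factorization_of_rankOne s (fun i _ => S.finrank_V i) P
    (by
      intro h
      obtain ⟨z, hz⟩ := S.exists_form_ne_zero (hc0 _ hb0)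
      rw [← hev, h] at hz
      simp at hz)
    hhom
    (by
      intro i hi z z' y y'
      apply MvPolynomial.funext
      intro p
      obtain ⟨x, rfl⟩ := hpoint p
      rw [map_mul, map_mul]
      by_cases hx : x = 0
      · simp only [hx, hzero, mul_zero]
      obtain ⟨y₀, hy₀, -, hk⟩ := hkill i hi x hx
      simp only [hev]
      exact mul_eq_mul_of_common_kernel (S.finrank_V i) ((S.form (c x)).toLinearMap z i)
        ((S.form (c x)).toLinearMap z' i) hy₀ (congrFun hk z) (congrFun hk z') y y')
    (by
      intro i hi y hy
      by_contra! hcon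
      have hy' : ∀ x, S.pairing i y (c x) = 0 := by
        intro x
        funext z
        rw [pairing_apply, ← hev, hcon, map_zero]; rfl
      -- otherwise `ψⱼ` would be constant
      have hconst : ∀ x (hx : x ≠ 0), S.curve j (Projectivization.mk K x hx) =
          S.curve i (Projectivization.mk K y hy) := by
        intro x hx
        obtain ⟨y₀, hy₀, h1, h2⟩ := hkill i hi x hx
        rw [h1]
        congr 1
        rw [Projectivization.mk_eq_mk_iff']
        exact S.exists_smul_eq_of_pairing_eq_zero (hc0 x hx) hy (hy' x) h2
      have h01 := S.curve_injective j ((hconst _ hb0).trans (hconst _ (b.ne_zero 1)).symm)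
      rw [Projectivization.mk_eq_mk_iff'] at h01
      obtain ⟨t, ht⟩ := h01
      have := congrArg (fun v => b.repr v 0) ht
      simp at this)
  obtain ⟨D, hD⟩ := exists_linearForm b
  refine ⟨c, fun i => D ∘ₗ q i, a, fun i hi => ?_, hcurve, fun x z => ?_, fun z z' h => ?_⟩
  · have hi' := (hmem i).2 hi
    have hinj : Function.Injective (D ∘ₗ q i) := by
      rw [injective_iff_map_eq_zero]
      intro y hy
      refine (injective_iff_map_eq_zero (q i)).1 (hq i hi').2 y (MvPolynomial.funext fun p => ?_)
      obtain ⟨x, rfl⟩ := hpoint p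
      rw [← hD _ ((hq i hi').1 y), ← LinearMap.comp_apply, hy]
      simp
    refine ⟨hinj, (LinearMap.injective_iff_surjective_of_finrank_eq_finrank ?_).1 hinj⟩
    rw [Subspace.dual_finrank_eq, S.finrank_V, S.finrank_V]
  · rw [← hev, hPq, map_mul, eval_C, map_prod]
    congr 1
    exact Finset.prod_congr rfl fun i hi => (hD _ ((hq i hi).1 _) x).symm
  · exact ha z z' fun i hi => h i fun h' => hi ((hmem i).2 h')

end FactorizationStructure

/-! ### Tensors of linear forms, evaluated on vectors -/

section Tensors

variable {K : Type w} [Field K]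

lemma finrank_span_singleton_tensor {ι : Type*} {V : ι → Type*} [∀ i, AddCommGroup (V i)]
    [∀ i, Module K (V i)] {t : ⨂[K] i, V i} (ht : t ≠ 0) : finrank K (K ∙ t) = 1 :=
  finrank_span_singleton ht

lemma eq_of_dualDistrib_tprod_eq {ι : Type*} [Finite ι] {V : ι → Type u}
    [∀ i, AddCommGroup (V i)] [∀ i, Module K (V i)] [∀ i, FiniteDimensional K (V i)]
    {s t : ⨂[K] i, Dual K (V i)}
    (h : ∀ x : ∀ i, V i, PiTensorProduct.dualDistrib s (PiTensorProduct.tprod K x) =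
      PiTensorProduct.dualDistrib t (PiTensorProduct.tprod K x)) : s = t := by
  refine (PiTensorProduct.dualDistribEquiv (R := K) (M := V)).injective ?_
  refine PiTensorProduct.ext (MultilinearMap.ext fun x => ?_)
  exact h x

lemma exists_dualDistrib_eq {ι : Type*} [Finite ι] {V : ι → Type u}
    [∀ i, AddCommGroup (V i)] [∀ i, Module K (V i)] [∀ i, FiniteDimensional K (V i)]
    (g : MultilinearMap K V K) : ∃ t : ⨂[K] i, Dual K (V i),
      ∀ x : ∀ i, V i, PiTensorProduct.dualDistrib t (PiTensorProduct.tprod K x) = g x := by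
  refine ⟨(PiTensorProduct.dualDistribEquiv (R := K) (M := V)).symm (PiTensorProduct.lift g),
    fun x => ?_⟩
  have h := (PiTensorProduct.dualDistribEquiv (R := K) (M := V)).apply_symm_apply
    (PiTensorProduct.lift g)
  have h' : PiTensorProduct.dualDistrib ((PiTensorProduct.dualDistribEquiv (R := K) (M := V)).symm
    (PiTensorProduct.lift g)) = PiTensorProduct.lift g := h
  rw [h', PiTensorProduct.lift.tprod]

lemma dualDistrib_map_reindex {ι κ : Type*} [Fintype ι] [Fintype κ]
    {V : ι → Type*} [∀ i, AddCommGroup (V i)] [∀ i, Module K (V i)]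
    {W : κ → Type*} [∀ j, AddCommGroup (W j)] [∀ j, Module K (W j)] (σ : κ ≃ ι)
    (g : ∀ j, W j →ₗ[K] V (σ j)) (t : ⨂[K] i, Dual K (V i)) (z : ∀ i, V i) (w : ∀ j, W j)
    (hzw : ∀ j, z (σ j) = g j (w j)) :
    PiTensorProduct.dualDistrib (PiTensorProduct.map (fun j => (g j).dualMap)
      (PiTensorProduct.reindex K (fun i => Dual K (V i)) σ.symm t)) (PiTensorProduct.tprod K w) =
    PiTensorProduct.dualDistrib t (PiTensorProduct.tprod K z) := by
  induction t using PiTensorProduct.induction_on with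
  | smul_tprod c x =>
    rw [map_smul, map_smul, map_smul, map_smul, PiTensorProduct.reindex_tprod,
      PiTensorProduct.map_tprod, LinearMap.smul_apply, LinearMap.smul_apply,
      PiTensorProduct.dualDistrib_apply, PiTensorProduct.dualDistrib_apply, ← Equiv.prod_comp σ]
    congr 1
    refine Finset.prod_congr rfl fun j _ => ?_
    rw [hzw]; rfl
  | add s t hs ht => simp only [map_add, LinearMap.add_apply, hs, ht]

variable {k : ℕ} {d : Fin k → ℕ} {W : Fin k → Type u} [∀ j, AddCommGroup (W j)]
  [∀ j, Module K (W j)]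

lemma dualDistrib_ins (j : Fin k) (μ : Fin (d j) → Dual K (W j))
    (γ : ⨂[K] s : OtherSlot d j, Dual K (W s.1.1)) (w : ∀ s : Slot d, W s.1) :
    PiTensorProduct.dualDistrib (ins d W j (PiTensorProduct.tprod K μ ⊗ₜ γ))
      (PiTensorProduct.tprod K w) = (∏ r, μ r (w ⟨j, r⟩)) *
        PiTensorProduct.dualDistrib γ (PiTensorProduct.tprod K fun s : OtherSlot d j => w s.1) := by
  induction γ using PiTensorProduct.induction_on with
  | smul_tprod c ν =>
    obtain ⟨f, hf₁, hf₂⟩ : ∃ f : ∀ s : Slot d, Dual K (W s.1),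
        (∀ r, f ⟨j, r⟩ = μ r) ∧ ∀ s : OtherSlot d j, f s.1 = ν s := by
      refine ⟨fun ⟨i, r⟩ => if h : i = j then by subst h; exact μ r else ν ⟨⟨i, r⟩, h⟩, ?_, ?_⟩
      · intro r; simp
      · rintro ⟨⟨i, r⟩, h⟩
        have h' : i ≠ j := h
        simp [h']
    obtain rfl : (fun r => f ⟨j, r⟩) = μ := funext hf₁
    obtain rfl : (fun s : OtherSlot d j => f s.1) = ν := funext hf₂
    rw [TensorProduct.tmul_smul, map_smul, map_smul, map_smul, ins_tmul, LinearMap.smul_apply,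
      LinearMap.smul_apply, PiTensorProduct.dualDistrib_apply, PiTensorProduct.dualDistrib_apply,
      ← (slotEquiv d j).prod_comp, Fintype.prod_sum_type]
    simp only [smul_eq_mul]
    rw [mul_left_comm]
    rfl
  | add s t hs ht =>
    simp only [TensorProduct.tmul_add, map_add, LinearMap.add_apply, hs, ht, mul_add]

/-- If the tensors `t x`, as multilinear forms, are products of the power of `u x` in the `j`th
group of slots with a function `a` of the other arguments, then `a` is given by a tensor `γ`,
obtained by fixing the arguments in the `j`th group. -/
lemma exists_ins_eq [∀ j, FiniteDimensional K (W j)] (j : Fin k) {X : Type*}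
    (t : X → ⨂[K] s : Slot d, Dual K (W s.1)) (u : X → Dual K (W j)) (a : (∀ s : Slot d, W s.1) → K)
    (ht : ∀ x w, PiTensorProduct.dualDistrib (t x) (PiTensorProduct.tprod K w) =
      (∏ r, u x (w ⟨j, r⟩)) * a w)
    (ha : ∀ w w', (∀ s : Slot d, s.1 ≠ j → w s = w' s) → a w = a w')
    (h0 : ∃ x, t x ≠ 0) :
    ∃ γ : ⨂[K] s : OtherSlot d j, Dual K (W s.1.1), γ ≠ 0 ∧
      ∀ x, t x = ins d W j ((PiTensorProduct.tprod K fun _ => u x) ⊗ₜ γ) := by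
  obtain ⟨x₀, hx₀⟩ := h0
  obtain ⟨w₀, hw₀⟩ : ∃ w, PiTensorProduct.dualDistrib (t x₀) (PiTensorProduct.tprod K w) ≠ 0 := by
    by_contra! hcon
    exact hx₀ (eq_of_dualDistrib_tprod_eq fun w => by rw [hcon]; simp)
  set p := ∏ r, u x₀ (w₀ ⟨j, r⟩) with hp
  have hp0 : p ≠ 0 := by
    rw [ht] at hw₀
    exact left_ne_zero_of_mul hw₀
  obtain ⟨γ, hγ⟩ := exists_dualDistrib_eq (V := fun s : OtherSlot d j => W s.1.1)
    (p⁻¹ • (PiTensorProduct.lift.symm (PiTensorProduct.dualDistrib (t x₀))).domDomRestrict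
      (fun s : Slot d => s.1 ≠ j) fun s => w₀ s.1)
  have hγa : ∀ w : ∀ s : Slot d, W s.1, PiTensorProduct.dualDistrib γ
      (PiTensorProduct.tprod K fun s : OtherSlot d j => w s.1) = a w := by
    intro w
    rw [hγ, smul_apply, MultilinearMap.domDomRestrict_apply]
    change p⁻¹ • PiTensorProduct.dualDistrib (t x₀) (PiTensorProduct.tprod K _) = _
    rw [ht]
    have h1 : ∏ r, u x₀ ((fun s : Slot d => if s.1 ≠ j then w s else w₀ s) ⟨j, r⟩) = p := by
      simp [hp]
    have h2 : a (fun s : Slot d => if s.1 ≠ j then w s else w₀ s) = a w :=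
      ha _ _ fun s hs => if_pos hs
    simp only [dite_eq_ite]
    rw [h1, h2, smul_eq_mul, inv_mul_cancel_left₀ hp0]
  have heq : ∀ x, t x = ins d W j ((PiTensorProduct.tprod K fun _ => u x) ⊗ₜ γ) := by
    intro x
    refine eq_of_dualDistrib_tprod_eq fun w => ?_
    rw [ht, dualDistrib_ins, hγa]
  refine ⟨γ, ?_, heq⟩
  rintro rfl
  refine hx₀ ?_
  rw [heq, TensorProduct.tmul_zero, map_zero]

lemma map₂_symmetricTensors_span [CharZero K] (j : Fin k)
    (γ : ⨂[K] s : OtherSlot d j, Dual K (W s.1.1)) :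
    (Submodule.map₂ (TensorProduct.mk K _ _) (symmetricTensors K (d j) (Dual K (W j)))
      (K ∙ γ)).map (ins (K := K) d W j).toLinearMap =
    Submodule.span K (Set.range fun μ : Dual K (W j) =>
      ins d W j ((PiTensorProduct.tprod K fun _ : Fin (d j) => μ) ⊗ₜ γ)) := by
  rw [symmetricTensors_eq_span, Submodule.map₂_span_span, Submodule.map_span]
  congr 1
  ext x
  simp [Set.image2]

lemma segreVeroneseSpace_span_singleton [CharZero K]
    (γ : ∀ j, ⨂[K] s : OtherSlot d j, Dual K (W s.1.1)) :
    segreVeroneseSpace d W (fun j => K ∙ γ j) =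
      ⨆ j, Submodule.span K (Set.range fun μ : Dual K (W j) =>
        ins d W j ((PiTensorProduct.tprod K fun _ : Fin (d j) => μ) ⊗ₜ γ j)) :=
  iSup_congr fun j => map₂_symmetricTensors_span j (γ j)

end Tensors

/-! ### The Segre-Veronese structure of a factorization structure with decomposable curves -/

/-- The elements of a finite type, labelled by the classes `κ` of an equivalence relation and by
positions `r < d κ` inside the classes; `rep κ` represents the class `κ`. -/
lemma exists_slot_labelling {ι : Type*} [Fintype ι] (r : Setoid ι) :
    ∃ (k : ℕ) (d : Fin k → ℕ) (rep : Fin k → ι) (σ : Slot d ≃ ι),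
      (∀ κ, 1 ≤ d κ) ∧ ∀ s κ, r (σ s) (rep κ) ↔ s.1 = κ := by
  classical
  let eQ := Fintype.equivFin (Quotient r)
  let cls : ι → Fin (Fintype.card (Quotient r)) := fun i => eQ (Quotient.mk r i)
  let σ : Slot (fun κ => Fintype.card {i // cls i = κ}) ≃ ι :=
    (Equiv.sigmaCongrRight fun κ => (Fintype.equivFin {i // cls i = κ}).symm).trans
      (Equiv.sigmaFiberEquiv cls)
  have hrep : ∀ κ, cls (eQ.symm κ).out = κ := by
    intro κ
    simp [cls]
  have hσ : ∀ s, cls (σ s) = s.1 := fun s =>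
    ((Fintype.equivFin {i // cls i = s.1}).symm s.2).2
  refine ⟨_, _, fun κ => (eQ.symm κ).out, σ, fun κ => ?_, fun s κ => ?_⟩
  · exact Fintype.card_pos_iff.2 ⟨⟨_, hrep κ⟩⟩
  · conv_rhs => rw [← hσ s, ← hrep κ]
    rw [eQ.injective.eq_iff, Quotient.eq]

namespace FactorizationStructure

variable {K : Type w} [Field K] [CharZero K] {m : ℕ} (S : FactorizationStructure.{u, v} K m)

/-- The hypothesis `1 ≤ m` is needed for the curves to span `𝔥`: for `m = 0` there are none. -/
theorem isSegreVeronese (hm : 1 ≤ m) (hS : S.AllCurvesDecomposable) : S.IsSegreVeronese := by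
  classical
  obtain ⟨k, d, rep, σ, hd, hσ⟩ := exists_slot_labelling
    (⟨S.CurvesEquivalent, fun _ => rfl, fun h => h.symm, fun h h' => h.trans h'⟩ :
      Setoid (Fin m))
  replace hσ : ∀ (s : Slot d) κ, S.CurvesEquivalent (σ s) (rep κ) ↔ s.1 = κ := hσ
  have hrefl : ∀ κ, S.CurvesEquivalent (rep κ) (rep κ) := fun _ => rfl
  let W : Fin k → Type u := fun κ => S.V (rep κ)
  choose c T a hT hc hform ha using fun κ => S.exists_curve_factorization (rep κ) (hS (rep κ))
  -- `Vᵢ` is identified with the space of the representing slot so that the linear factors agree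
  let g : ∀ s : Slot d, W s.1 ≃ₗ[K] S.V (σ s) := fun s =>
    (LinearEquiv.ofBijective _ (hT s.1 (rep s.1) (hrefl _))).trans
      (LinearEquiv.ofBijective _ (hT s.1 (σ s) ((hσ s s.1).2 rfl))).symm
  have hg : ∀ s w, T s.1 (σ s) (g s w) = T s.1 (rep s.1) w := fun s w =>
    (LinearEquiv.ofBijective _ (hT s.1 (σ s) ((hσ s s.1).2 rfl))).apply_symm_apply _
  let f : ∀ s : Slot d, Dual K (S.V (σ s)) ≃ₗ[K] Dual K (W s.1) := fun s => (g s).dualMap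
  let E : (⨂[K] i, Dual K (S.V i)) ≃ₗ[K] ⨂[K] s : Slot d, Dual K (W s.1) :=
    (PiTensorProduct.reindex K (fun i => Dual K (S.V i)) σ.symm).trans (PiTensorProduct.congr f)
  let z : (∀ s : Slot d, W s.1) → ∀ i, S.V i := fun w =>
    Equiv.piCongrLeft S.V σ fun s => g s (w s)
  have hz : ∀ w s, z w (σ s) = g s (w s) := fun w s =>
    Equiv.piCongrLeft_apply_apply S.V σ _ s
  have hE : ∀ t w, PiTensorProduct.dualDistrib (E t) (PiTensorProduct.tprod K w) =
      PiTensorProduct.dualDistrib t (PiTensorProduct.tprod K (z w)) := fun t w =>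
    dualDistrib_map_reindex σ (fun s => (g s).toLinearMap) t (z w) w (hz w)
  have hprod : ∀ κ x w, PiTensorProduct.dualDistrib (E (S.φ (c κ x)))
      (PiTensorProduct.tprod K w) =
      (∏ r, (T κ (rep κ)).flip x (w ⟨κ, r⟩)) * a κ (z w) := by
    intro κ x w
    rw [hE, ← form_apply, hform]
    congr 1
    symm
    refine Finset.prod_bij (fun r _ => σ ⟨κ, r⟩) ?_ ?_ ?_ ?_
    · intro r _
      exact Finset.mem_filter.2 ⟨Finset.mem_univ _, (hσ _ _).2 rfl⟩
    · intro r _ r' _ h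
      simpa using σ.injective h
    · intro i hi
      obtain ⟨⟨κ', r⟩, rfl⟩ := σ.surjective i
      obtain rfl : κ' = κ := (hσ _ _).1 (Finset.mem_filter.1 hi).2
      exact ⟨r, Finset.mem_univ _, rfl⟩
    · intro r _
      rw [hz, hg ⟨κ, r⟩]; rfl
  have hW : ∀ κ, finrank K (W κ) = 2 := fun κ => S.finrank_V _
  have hγ : ∀ κ, ∃ γ : ⨂[K] s : OtherSlot d κ, Dual K (W s.1.1), γ ≠ 0 ∧
      ∀ x, E (S.φ (c κ x)) =
        ins d W κ ((PiTensorProduct.tprod K fun _ => (T κ (rep κ)).flip x) ⊗ₜ γ) := by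
    intro κ
    refine exists_ins_eq κ (fun x => E (S.φ (c κ x))) (T κ (rep κ)).flip (fun w => a κ (z w))
      (hprod κ) ?_ ?_
    · intro w w' h
      refine ha κ _ _ fun i hi => ?_
      obtain ⟨s, rfl⟩ := σ.surjective i
      rw [hz, hz, h s fun h' => hi ((hσ _ _).2 h')]
    · have : Nontrivial (S.V (rep κ)) :=
        Module.nontrivial_of_finrank_pos (R := K) (by rw [S.finrank_V]; exact two_pos)
      obtain ⟨x, hx⟩ := exists_ne (0 : S.V (rep κ))
      refine ⟨x, fun h => ?_⟩
      rw [LinearEquiv.map_eq_zero_iff, map_eq_zero_iff _ S.injective] at h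
      obtain ⟨h', hh', hne⟩ := S.exists_mem_curve (rep κ) (Projectivization.mk K x hx)
      rw [hc, h, Submodule.span_zero_singleton] at hh'
      exact hne hh'
  choose γ hγ0 hγ using hγ
  -- every linear form on `W κ` occurs as the linear factor of some point of the curve
  have hflip : ∀ κ, Function.Surjective (T κ (rep κ)).flip := by
    intro κ
    have hinj : Function.Injective (T κ (rep κ)).flip := by
      rw [injective_iff_map_eq_zero]
      intro x hx
      rw [← Module.forall_dual_apply_eq_zero_iff K]
      intro f
      obtain ⟨y, rfl⟩ := (hT κ (rep κ) (hrefl κ)).2 f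
      exact LinearMap.congr_fun hx y
    refine (LinearMap.injective_iff_surjective_of_finrank_eq_finrank ?_).1 hinj
    rw [Subspace.dual_finrank_eq]
  have hspace : segreVeroneseSpace d W (fun κ => K ∙ γ κ) =
      LinearMap.range (E.toLinearMap ∘ₗ S.φ) := by
    rw [segreVeroneseSpace_span_singleton]
    apply le_antisymm
    · refine iSup_le fun κ => ?_
      rw [Submodule.span_le]
      rintro _ ⟨μ, rfl⟩
      obtain ⟨x, rfl⟩ := hflip κ μ
      exact ⟨c κ x, hγ κ x⟩
    · rw [LinearMap.range_eq_map, ← S.iSup_linearSpan_curve hm, Submodule.map_iSup]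
      refine iSup_le fun j => ?_
      set κ := (σ.symm j).1 with hκ
      have hj : S.CurvesEquivalent j (rep κ) := by
        have := (hσ (σ.symm j) κ).2 rfl
        rwa [σ.apply_symm_apply] at this
      rw [linearSpan, Submodule.map_iSup]
      refine iSup_le fun ℓ => ?_
      obtain ⟨ℓ', hℓ'⟩ : S.curve j ℓ ∈ Set.range (S.curve (rep κ)) := by
        rw [← (hj : Set.range _ = Set.range _)]; exact ⟨ℓ, rfl⟩
      rw [← hℓ']
      induction ℓ' with | h x hx => ?_
      rw [hc, Submodule.map_span, Set.image_singleton, Submodule.span_singleton_le_iff_mem]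
      exact Submodule.mem_iSup_of_mem κ (Submodule.subset_span ⟨_, (hγ κ x).symm⟩)
  have hinj : Function.Injective (E.toLinearMap ∘ₗ S.φ) := E.injective.comp S.injective
  have hΓ : ∀ κ, finrank K (K ∙ γ κ) = 1 := fun κ => finrank_span_singleton_tensor (hγ0 κ)
  let D : SegreVeroneseData.{u} K m :=
    { k := k
      d := d
      d_pos := hd
      sum_d := by simpa using Fintype.card_congr σ
      W := W
      finrank_W := hW
      Γ := fun κ => K ∙ γ κ
      finrank_Γ := hΓ
      finrank_space := by rw [hspace, LinearMap.finrank_range_of_inj hinj, S.finrank_𝔥] }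
  obtain ⟨Φ, hΦ⟩ : ∃ Φ : S.𝔥 ≃ₗ[K] segreVeroneseSpace d W (fun κ => K ∙ γ κ),
      ∀ h, (Φ h : ⨂[K] s : Slot d, Dual K (W s.1)) = E (S.φ h) :=
    ⟨(LinearEquiv.ofInjective _ hinj).trans (LinearEquiv.ofEq _ _ hspace.symm), fun _ => rfl⟩
  exact ⟨D, Φ, σ, f, hΦ⟩

end FactorizationStructure

end FactStr

end

theorem theorem2p21 (𝕜 : Type w) [RCLike 𝕜] :
    -- (i) the inductive step from dimension m - 1 to dimension m
    (∀ m : ℕ, 2 ≤ m →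
      (∀ S : FactStr.FactorizationStructure.{u, v} 𝕜 (m - 1),
        S.AllCurvesDecomposable → S.IsSegreVeronese) →
      ∀ S : FactStr.FactorizationStructure.{u, v} 𝕜 m,
        S.AllCurvesDecomposable → S.IsSegreVeronese) ∧
    -- (ii) the conclusion, in every dimension
    (∀ m : ℕ, 1 ≤ m → ∀ S : FactStr.FactorizationStructure.{u, v} 𝕜 m,
      S.AllCurvesDecomposable →
        S.IsSegreVeronese ∧ ⨆ j : Fin m, FactStr.linearSpan (S.curve j) = ⊤) :=
  ⟨fun _ hm _ S hS => S.isSegreVeronese (by omega) hS,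
    fun _ hm S hS => ⟨S.isSegreVeronese hm hS, S.iSup_linearSpan_curve hm⟩⟩
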